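/- Let $K$ be a field of characteristic zero, let $n \geq 3$, and let $\mathrm{GA}_n(K)$ be the group of polynomial automorphisms of affine $n$-space over $K$, with composition of maps as product; we write $\varphi = (F_1,\ldots,F_n)$ with components $F_i \in K[x_1,\ldots,x_n]$. An automorphism is called affine if all its components have degree one, and triangular if it is of the form $(u_1x_1+P_1, u_2x_2+P_2,\ldots,u_nx_n+P_n)$ with $u_i \in K^*$ and $P_i \in K[x_1,\ldots,x_{i-1}]$. The tame subgroup is the subgroup of $\mathrm{GA}_n(K)$ generated by all affine and all triangular automorphisms. An automorphism $\varphi$ is called co-tame if the subgroup generated by $\varphi$ and all affine automorphisms contains the tame subgroup. Let $\varphi \in \mathrm{GA}_n(K)$ and fix $1 \leq r \leq n$. For $c \in K$ set $\theta_{r,c} = (x_1,\ldots,x_{r-1},x_r+c,x_{r+1},\ldots,x_n)$. If $\varphi^{-1}\theta_{r,c}\varphi$ is affine for every $c \in K$, then $\varphi$ is either affine or co-tame. -/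

import Mathlib

open MvPolynomial

noncomputable section

/-- The group of polynomial automorphisms of affine `n`-space over `K`. An automorphism `φ` is
given by the `K`-algebra automorphism `P ↦ (P)φ` of `K[x_1, …, x_n]` it induces. The opposite
group is taken, so that `(P)(φ * ψ) = ((P)φ)ψ`; in other words the product is the usual
composition of maps of affine space. -/
abbrev GA (n : ℕ) (K : Type*) [Field K] : Type _ :=
  (MvPolynomial (Fin n) K ≃ₐ[K] MvPolynomial (Fin n) K)ᵐᵒᵖ

namespace GA

variable {n : ℕ} {K : Type*} [Field K]

/-- The `i`-th component `(x_i)φ` of `φ`, so that `φ = ((x_1)φ, …, (x_n)φ)`. -/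
def component (φ : GA n K) (i : Fin n) : MvPolynomial (Fin n) K :=
  φ.unop (X i)

/-- `φ` is affine: all its components have degree one. -/
def IsAffine (φ : GA n K) : Prop :=
  ∀ i, (φ.component i).totalDegree = 1

/-- `φ` is (lower) triangular: `φ = (u_1 x_1 + P_1, …, u_n x_n + P_n)`, where each `u_i` is a
unit of `K` and `P_i ∈ K[x_1, …, x_{i-1}]`. -/
def IsTriangular (φ : GA n K) : Prop :=
  ∀ i, ∃ u : Kˣ, ∃ P ∈ supported K (Set.Iio i), φ.component i = C (u : K) * X i + P

variable (n K) in
/-- The tame subgroup: the one generated by the affine and the triangular automorphisms. -/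
def tame : Subgroup (GA n K) :=
  Subgroup.closure {φ | φ.IsAffine ∨ φ.IsTriangular}

/-- `φ` is co-tame: the subgroup generated by `φ` and the affine automorphisms contains the
tame subgroup. -/
def IsCotame (φ : GA n K) : Prop :=
  tame n K ≤ Subgroup.closure (insert φ {α | α.IsAffine})

theorem translation_aux (r : Fin n) (c d : K) (h : c + d = 0) :
    (aeval (R := K) (Function.update X r (X r + C c))).comp
      (aeval (R := K) (Function.update X r (X r + C d))) =
      AlgHom.id K (MvPolynomial (Fin n) K) := by
  apply MvPolynomial.algHom_ext
  intro i
  by_cases hi : i = r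
  · subst hi
    simp [algebraMap_eq, add_assoc, ← C_add, h]
  · simp [hi]

/-- The translation `θ_{r,c} = (x_1, …, x_{r-1}, x_r + c, x_{r+1}, …, x_n)`. -/
def translation (r : Fin n) (c : K) : GA n K :=
  MulOpposite.op <| AlgEquiv.ofAlgHom
    (aeval (Function.update X r (X r + C c)))
    (aeval (Function.update X r (X r + C (-c))))
    (translation_aux r c (-c) (add_neg_cancel c))
    (translation_aux r (-c) c (neg_add_cancel c))

end GA

end

/-! Let `H` be the group generated by `φ` and the affine automorphisms, acting on polynomials. For
each `r`, the polynomials `p` free of `x_r` with `x_r ↦ x_r + p` in `H` form a subspace `shears H hH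
r`. If one of these spaces contains a `p` of degree at least two, Derksen's theorem
(`mem_shears_of_two_le`) puts every shear in `H`, hence every triangular map (`triangular_mem`), and
`φ` is co-tame. So assume that all shears in `H` are affine; it must be shown that `φ` is affine.

Put `D = φ ∂_r φ⁻¹`. Differentiating the hypothesis in `c` shows that each `D x_i` has degree at
most one. If `D` has constant coefficients, an affine change of coordinates turns it into `∂_r`, and
`isAffine_of_pderiv_comm` applies.

Otherwise let `W` be the image under `φ` of the shear polynomials for `r`; it lies in `ker D`. Let
`∂_v` be a nonzero constant derivation commuting with `D`. If `f ∈ W` and `∂_v f = 0`, then `exp(c f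
D)` lies in `H` and commutes with `∂_v`, so it is affine; thus each `f * D x_i` has degree at most
one and `f` is constant (`totalDegree_eq_zero_of_dirDeriv_eq_zero`). Also `∂_v` preserves `W`.

Such `v` correspond to functionals on `V / D V`, where `V` is the space of affine functions. If this
quotient has dimension at least two, some combination of two such derivations kills a nonconstant
element of minimal degree in `W`, a contradiction. If it has dimension one, `D` is a single Jordan
block on `V` (`exists_regular_coordinates`), and a grading argument modulo `n` excludes it
(`false_of_regular`). Dimension zero is impossible since `D` is nilpotent on `V`. -/

noncomputable section

/-! ### Coefficients of polynomial families in a subspace -/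

section Vandermonde

variable {K A : Type*} [Field K] [CharZero K] [CommRing A] [Algebra K A]

/-- If a polynomial with coefficients in a `K`-algebra takes values in a subspace at all nonzero
scalars, then its coefficients lie in that subspace. -/
theorem Polynomial.coeff_mem_of_eval_mem (S : Submodule K A) (R : Polynomial A)
    (h : ∀ c : K, c ≠ 0 → R.eval (algebraMap K A c) ∈ S) (k : ℕ) : R.coeff k ∈ S := by
  by_contra hk
  -- A functional killing `S` but not the coefficient turns `R` into a scalar polynomial with
  -- infinitely many roots.
  obtain ⟨l, hl, hS⟩ := Submodule.exists_le_ker_of_notMem hk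
  let P : Polynomial K := ∑ j ∈ R.support, Polynomial.monomial j (l (R.coeff j))
  have hP : P = 0 := by
    refine Polynomial.eq_zero_of_infinite_isRoot P (Set.Infinite.mono ?_
      (Set.Finite.infinite_compl (Set.finite_singleton (0 : K))))
    intro c hc
    have := hS (h c hc)
    rw [LinearMap.mem_ker, Polynomial.eval_eq_sum, Polynomial.sum, map_sum] at this
    simp only [Set.mem_ofPred_eq, Polynomial.IsRoot, P, Polynomial.eval_finsetSum,
      Polynomial.eval_monomial]
    rw [← this]
    refine Finset.sum_congr rfl fun j _ => ?_
    rw [← map_pow, mul_comm (R.coeff j), ← Algebra.smul_def, map_smul, smul_eq_mul, mul_comm]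
  have hc : P.coeff k = l (R.coeff k) := by
    simp only [P, Polynomial.finsetSum_coeff, Polynomial.coeff_monomial]
    rw [Finset.sum_ite_eq']
    split_ifs with hk'
    · rfl
    · rw [Polynomial.notMem_support_iff.1 hk', map_zero]
  exact hl (by rw [← hc, hP, Polynomial.coeff_zero])

end Vandermonde

/-! ### Derivations and degrees in polynomial rings -/

namespace MvPolynomial

variable {σ K : Type*} [Field K]

/-- The derivation gives the coefficient of `c` in the expansion of `Q(X + c g)`. This is how
group-theoretic membership is differentiated throughout. -/
theorem mkDerivation_mem [CharZero K] (S : Submodule K (MvPolynomial σ K))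
    (g : σ → MvPolynomial σ K) (Q : MvPolynomial σ K)
    (h : ∀ c : K, aeval (fun i => X i + C c * g i) Q ∈ S) : mkDerivation K g Q ∈ S := by
  let ψ : MvPolynomial σ K →ₐ[K] Polynomial (MvPolynomial σ K) :=
    aeval fun i => Polynomial.C (X i) + Polynomial.X * Polynomial.C (g i)
  have h0 (P : MvPolynomial σ K) : (ψ P).coeff 0 = P := by
    induction P using MvPolynomial.induction_on with
    | C a => simp [ψ, Polynomial.algebraMap_eq,
        IsScalarTower.algebraMap_apply K (MvPolynomial σ K) (Polynomial (MvPolynomial σ K)),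
        algebraMap_eq]
    | add p q hp hq => simp [hp, hq]
    | mul_X p i hp => rw [map_mul, Polynomial.mul_coeff_zero, hp]; simp [ψ]
  have h1 (P : MvPolynomial σ K) : (ψ P).coeff 1 = mkDerivation K g P := by
    induction P using MvPolynomial.induction_on with
    | C a => simp [ψ, IsScalarTower.algebraMap_apply K (MvPolynomial σ K)
        (Polynomial (MvPolynomial σ K)), algebraMap_eq]
    | add p q hp hq => simp [hp, hq]
    | mul_X p i hp =>
      rw [map_mul, Polynomial.mul_coeff_one, hp, h0, Derivation.leibniz]
      simp [ψ, Polynomial.coeff_C]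
      ring
  have h2 (c : K) (P : MvPolynomial σ K) :
      (ψ P).eval (C c) = aeval (fun i => X i + C c * g i) P := by
    induction P using MvPolynomial.induction_on with
    | C a => simp [ψ, IsScalarTower.algebraMap_apply K (MvPolynomial σ K)
        (Polynomial (MvPolynomial σ K)), algebraMap_eq]
    | add p q hp hq => simp [hp, hq]
    | mul_X p i hp => rw [map_mul, map_mul, Polynomial.eval_mul, hp]; simp [ψ, mul_comm (C c)]
  rw [← h1]
  refine Polynomial.coeff_mem_of_eval_mem S _ (fun c _ => ?_) 1
  rw [algebraMap_eq, h2]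
  exact h c

theorem vars_of_pderiv_eq_zero [CharZero K] {r : σ} {p : MvPolynomial σ K}
    (h : pderiv r p = 0) : r ∉ p.vars := by
  intro hr
  obtain ⟨m, hm, hmr⟩ := (mem_vars_iff_mem_support r).1 hr
  have h1 := coeff_pderiv p (i := r) (m - Finsupp.single r 1)
  have h2 : m - Finsupp.single r 1 + Finsupp.single r 1 = m :=
    tsub_add_cancel_of_le (by simpa using Nat.one_le_iff_ne_zero.2 (Finsupp.mem_support_iff.1 hmr))
  rw [h, h2, coeff_zero] at h1
  have h3 := mem_support_iff.1 hm
  have h4 : ((m r - 1 : ℕ) : K) + 1 ≠ 0 := Nat.cast_add_one_ne_zero _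
  simp_all

theorem algHom_congr_of_pderiv_eq_zero [CharZero K] {A : Type*} [CommRing A] [Algebra K A]
    {r : σ} {p : MvPolynomial σ K} (h : pderiv r p = 0) {f g : MvPolynomial σ K →ₐ[K] A}
    (hfg : ∀ i, i ≠ r → f (X i) = g (X i)) : f p = g p := by
  have := hom_congr_vars (f₁ := (f : MvPolynomial σ K →+* A))
    (f₂ := (g : MvPolynomial σ K →+* A)) (p₁ := p) (p₂ := p) (by ext; simp)
    (fun i hi _ => hfg i (by rintro rfl; exact vars_of_pderiv_eq_zero h hi)) rfl
  exact this

theorem totalDegree_pderiv_le (i : σ) (p : MvPolynomial σ K) :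
    (pderiv i p).totalDegree ≤ p.totalDegree - 1 := by
  refine Finset.sup_le fun m hm => ?_
  have h1 : coeff (m + Finsupp.single i 1) p ≠ 0 := by
    intro h0
    have h1 := coeff_pderiv p (i := i) m
    rw [h0] at h1
    exact mem_support_iff.1 hm (by simpa using h1)
  have h2 := le_totalDegree (mem_support_iff.2 h1)
  rw [Finsupp.sum_add_index' (by simp) (by simp)] at h2
  simp at h2
  omega

theorem eq_C_add_sum_of_totalDegree_le_one [Fintype σ] {p : MvPolynomial σ K}
    (h : p.totalDegree ≤ 1) :
    p = C (coeff 0 p) + ∑ i, C (coeff (Finsupp.single i 1) p) * X i := by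
  classical
  ext m
  by_cases hm : m.degree ≤ 1
  · rcases Nat.le_one_iff_eq_zero_or_eq_one.1 hm with h0 | h1
    · obtain rfl := (Finsupp.degree_eq_zero_iff m).1 h0
      simp [coeff_sum, coeff_C_mul, coeff_X]
    · obtain ⟨j, rfl⟩ : m ∈ Set.range fun i : σ => Finsupp.single i 1 := by
        rw [Finsupp.range_single_one]; exact h1
      simp [coeff_sum, coeff_C_mul, coeff_X, Finsupp.single_left_inj, coeff_C]
      exact fun h0 => by simpa using DFunLike.congr_fun h0 j
  · have h1 (q : MvPolynomial σ K) (hq : q.totalDegree ≤ 1) : coeff m q = 0 := by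
      by_contra hc
      exact hm ((le_totalDegree (mem_support_iff.2 hc)).trans hq)
    rw [h1 p h, h1]
    refine (totalDegree_add _ _).trans (max_le (by simp) ?_)
    refine (totalDegree_finsetSum_le fun i _ => ?_)
    exact (totalDegree_mul _ _).trans (by simp)

/-- Both sides are derivations along `β`, so the variables decide. -/
theorem derivation_algHom_comm {σ K : Type*} [Field K]
    {D D' : Derivation K (MvPolynomial σ K) (MvPolynomial σ K)}
    {β : MvPolynomial σ K →ₐ[K] MvPolynomial σ K} (h : ∀ i, D (β (X i)) = β (D' (X i)))
    (f : MvPolynomial σ K) : D (β f) = β (D' f) := by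
  induction f using MvPolynomial.induction_on with
  | C a => simp [← algebraMap_eq]
  | add p q hp hq => simp [hp, hq]
  | mul_X p i hp => simp [hp, h]

theorem mkDerivation_single {σ K : Type*} [Field K] [DecidableEq σ] (i : σ)
    (q f : MvPolynomial σ K) :
    mkDerivation K (Pi.single i q : σ → MvPolynomial σ K) f = q * pderiv i f := by
  have : mkDerivation K (Pi.single i q : σ → MvPolynomial σ K) = q • pderiv i := by
    refine derivation_ext fun j => ?_
    by_cases hj : j = i
    · subst hj; simp
    · simp [pderiv_X_of_ne hj, hj]
  simp [this]

end MvPolynomial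

/-! ### Automorphisms with prescribed components -/

/-- A surjective endomorphism of a Noetherian ring is injective. -/
theorem RingHom.injective_of_surjective_of_isNoetherianRing {R : Type*} [CommRing R]
    [IsNoetherianRing R] (f : R →+* R) (hf : Function.Surjective f) : Function.Injective f := by
  let k : ℕ →o Ideal R :=
    ⟨fun m => RingHom.ker (f ^ m), monotone_nat_of_le_succ fun m x hx => by
      rw [RingHom.mem_ker] at hx ⊢
      rw [pow_succ', RingHom.mul_def, RingHom.comp_apply, hx, map_zero]⟩
  obtain ⟨m, hm⟩ := monotone_stabilizes_iff_noetherian.2 ‹_› k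
  have hs : Function.Surjective (f ^ m) := by
    rw [RingHom.coe_pow]
    exact hf.iterate m
  refine (injective_iff_map_eq_zero f).2 fun x hx => ?_
  obtain ⟨y, rfl⟩ := hs x
  have : y ∈ k (m + 1) := by
    change (f ^ (m + 1)) y = 0
    rw [pow_succ', RingHom.mul_def, RingHom.comp_apply, hx]
  rw [← hm (m + 1) m.le_succ] at this
  exact this

/-- The group of automorphisms of the `K`-algebra `K[x_1, …, x_n]`. -/
abbrev PolyAut (n : ℕ) (K : Type*) [Field K] : Type _ :=
  MvPolynomial (Fin n) K ≃ₐ[K] MvPolynomial (Fin n) K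

namespace PolyAut

variable {n : ℕ} {K : Type*} [Field K]

/-- All components have degree at most one. -/
def IsAffine (e : PolyAut n K) : Prop :=
  ∀ i, (e (X i)).totalDegree ≤ 1

theorem totalDegree_apply_ne_zero (e : PolyAut n K) (i : Fin n) : (e (X i)).totalDegree ≠ 0 := by
  intro h
  have h1 := e.injective ((totalDegree_eq_zero_iff_eq_C.1 h).trans (e.commutes _).symm)
  have h2 := congrArg totalDegree h1
  simp [algebraMap_eq] at h2

/-- The automorphism with prescribed components, from the fact that these generate. -/
def ofSurjective (g : Fin n → MvPolynomial (Fin n) K) (h : ∀ i, X i ∈ (aeval (R := K) g).range) :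
    PolyAut n K :=
  have hs : Function.Surjective (aeval (R := K) g) := by
    rw [← AlgHom.range_eq_top, ← top_le_iff, ← adjoin_range_X, Algebra.adjoin_le_iff]
    rintro _ ⟨i, rfl⟩
    exact h i
  AlgEquiv.ofBijective (aeval g)
    ⟨RingHom.injective_of_surjective_of_isNoetherianRing
      (aeval (R := K) g : MvPolynomial (Fin n) K →+* MvPolynomial (Fin n) K) hs, hs⟩

@[simp]
theorem ofSurjective_X (g : Fin n → MvPolynomial (Fin n) K)
    (h : ∀ i, X i ∈ (aeval (R := K) g).range) (i : Fin n) : ofSurjective g h (X i) = g i := by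
  simp [ofSurjective]

theorem ext_X {e f : PolyAut n K} (h : ∀ i, e (X i) = f (X i)) : e = f :=
  AlgEquiv.coe_toAlgHom_injective (MvPolynomial.algHom_ext h)

variable (K) in
/-- The automorphism multiplying each variable by a nonzero scalar. -/
def dilation (t : Fin n → K) (ht : ∀ i, t i ≠ 0) : PolyAut n K :=
  ofSurjective (fun i => C (t i) * X i) fun i =>
    ⟨C (t i)⁻¹ * X i, by simp [← mul_assoc, ← C_mul, ht i]⟩

@[simp]
theorem dilation_X (t : Fin n → K) (ht : ∀ i, t i ≠ 0) (i : Fin n) :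
    dilation K t ht (X i) = C (t i) * X i :=
  ofSurjective_X _ _ i

theorem dilation_isAffine (t : Fin n → K) (ht : ∀ i, t i ≠ 0) : (dilation K t ht).IsAffine :=
  fun i => by rw [dilation_X]; exact (totalDegree_mul _ _).trans (by simp)

theorem pderiv_apply_of_X (e : PolyAut n K) (r : Fin n) (t : K)
    (h : ∀ i, pderiv r (e (X i)) = t • e (pderiv r (X i))) (f : MvPolynomial (Fin n) K) :
    pderiv r (e f) = t • e (pderiv r f) := by
  rw [← map_smul]
  exact derivation_algHom_comm (D := pderiv r) (D' := t • pderiv r)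
    (β := (e : MvPolynomial (Fin n) K →ₐ[K] MvPolynomial (Fin n) K))
    (fun i => (h i).trans (map_smul e t _).symm) f

theorem pderiv_dilation (t : Fin n → K) (ht : ∀ i, t i ≠ 0) (r : Fin n)
    (f : MvPolynomial (Fin n) K) :
    pderiv r (dilation K t ht f) = t r • dilation K t ht (pderiv r f) := by
  refine pderiv_apply_of_X _ r _ (fun i => ?_) f
  rw [dilation_X, pderiv_C_mul]
  by_cases hi : i = r
  · subst hi
    rw [pderiv_X_self, map_one, mul_one, smul_eq_C_mul, mul_one]
  · rw [pderiv_X_of_ne hi, mul_zero, map_zero, smul_zero]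

variable (K) in
/-- The automorphism permuting the variables. -/
def perm (s : Equiv.Perm (Fin n)) : PolyAut n K := renameEquiv K s

theorem perm_isAffine (s : Equiv.Perm (Fin n)) : (perm K s).IsAffine := fun i => by simp [perm]

theorem mul_X (e f : PolyAut n K) (i : Fin n) : (e * f) (X i) = e (f (X i)) := rfl

/-! ### Shears and the spaces of shear polynomials of a group -/

variable [CharZero K]

/-- The automorphism adding to the variable `x_r` a polynomial in the other variables. -/
def shear (r : Fin n) (p : MvPolynomial (Fin n) K) (hp : pderiv r p = 0) : PolyAut n K :=
  have key (q q' : MvPolynomial (Fin n) K) (hq : pderiv r q = 0) (hqq' : q + q' = 0) :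
      (aeval (R := K) (Function.update X r (X r + q'))).comp
        (aeval (R := K) (Function.update X r (X r + q))) = AlgHom.id K _ := by
    refine MvPolynomial.algHom_ext fun i => ?_
    by_cases hi : i = r
    · subst hi
      have : aeval (R := K) (Function.update X i (X i + q')) q = q :=
        algHom_congr_of_pderiv_eq_zero (g := AlgHom.id K _) hq fun j hj => by simp [hj]
      simp only [AlgHom.comp_apply, aeval_X, Function.update_self, map_add, this, AlgHom.id_apply]
      rw [add_assoc, add_comm q', hqq', add_zero]
    · simp [hi]
  AlgEquiv.ofAlgHom (aeval (Function.update X r (X r + p)))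
    (aeval (Function.update X r (X r + -p)))
    (key (-p) p (by simp [hp]) (neg_add_cancel p)) (key p (-p) hp (add_neg_cancel p))

section shear

variable {r : Fin n} {p : MvPolynomial (Fin n) K} (hp : pderiv r p = 0)

theorem shear_apply (f : MvPolynomial (Fin n) K) :
    shear r p hp f = aeval (Function.update X r (X r + p)) f := rfl

@[simp]
theorem shear_X_self : shear r p hp (X r) = X r + p := by simp [shear_apply]

theorem shear_X_of_ne {i : Fin n} (hi : i ≠ r) : shear r p hp (X i) = X i := by
  simp [shear_apply, hi]

theorem shear_apply_of_pderiv_eq_zero {q : MvPolynomial (Fin n) K} (hq : pderiv r q = 0) :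
    shear r p hp q = q :=
  algHom_congr_of_pderiv_eq_zero (f := (shear r p hp : _ →ₐ[K] _)) (g := AlgHom.id K _) hq
    fun _ hj => shear_X_of_ne hp hj

/-- Conjugation of a shear by an automorphism normalising the translations in its direction. -/
theorem mul_shear_eq (β : PolyAut n K) {t : K} (ht : t ≠ 0)
    (hβ : ∀ f, pderiv r (β f) = t • β (pderiv r f)) (hq : pderiv r (t⁻¹ • β p) = 0) :
    β * shear r p hp = shear r (t⁻¹ • β p) hq * β := by
  have h0 (f : MvPolynomial (Fin n) K) (hf : pderiv r f = 0) : pderiv r (β f) = 0 := by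
    rw [hβ, hf, map_zero, smul_zero]
  refine ext_X fun i => ?_
  rw [mul_X, mul_X]
  by_cases hi : i = r
  · subst hi
    have h1 : pderiv i (β (X i) - t • X i) = 0 := by simp [hβ]
    have h2 := shear_apply_of_pderiv_eq_zero hq h1
    rw [map_sub, map_smul, shear_X_self, smul_add, smul_inv_smul₀ ht, sub_eq_iff_eq_add] at h2
    rw [h2, shear_X_self, map_add]
    ring
  · rw [shear_X_of_ne hp hi, shear_apply_of_pderiv_eq_zero]
    exact h0 _ (pderiv_X_of_ne hi)

theorem shear_mul_shear {q : MvPolynomial (Fin n) K} (hq : pderiv r q = 0) :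
    shear r p hp * shear r q hq = shear r (p + q) (by simp [hp, hq]) := by
  refine ext_X fun i => ?_
  by_cases hi : i = r
  · subst hi
    rw [mul_X, shear_X_self, map_add, shear_X_self, shear_apply_of_pderiv_eq_zero hp hq,
      shear_X_self, add_assoc]
  · rw [mul_X, shear_X_of_ne _ hi, shear_X_of_ne _ hi, shear_X_of_ne _ hi]

theorem shear_isAffine (h : p.totalDegree ≤ 1) : (shear r p hp).IsAffine := fun i => by
  by_cases hi : i = r
  · subst hi
    rw [shear_X_self]
    exact (totalDegree_add _ _).trans (by simp [h])
  · simp [shear_X_of_ne _ hi]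

end shear

/-- The polynomials `p` not involving `x_r` such that `x_r ↦ x_r + p` belongs to a group
containing all affine automorphisms. -/
def shears (H : Subgroup (PolyAut n K)) (hH : ∀ e : PolyAut n K, e.IsAffine → e ∈ H) (r : Fin n) :
    Submodule K (MvPolynomial (Fin n) K) where
  carrier := {p | ∃ hp : pderiv r p = 0, shear r p hp ∈ H}
  add_mem' := by
    rintro p q ⟨hp, hp'⟩ ⟨hq, hq'⟩
    exact ⟨by simp [hp, hq], by rw [← shear_mul_shear hp hq]; exact H.mul_mem hp' hq'⟩
  zero_mem' := ⟨by simp, hH _ (shear_isAffine _ (by simp))⟩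
  smul_mem' := by
    rintro c p ⟨hp, hp'⟩
    by_cases hc : c = 0
    · subst hc
      exact ⟨by simp, hH _ (shear_isAffine _ (by simp))⟩
    -- Scaling `x_r` alone fixes `p`; conjugation divides `p` by the factor, hence the inverse of
    -- `c`.
    let t : Fin n → K := Function.update 1 r c⁻¹
    have ht : ∀ i, t i ≠ 0 := fun i => by
      by_cases hi : i = r
      · subst hi; simpa [t] using hc
      · simp [t, hi]
    have hcp : pderiv r (c • p) = 0 := by simp [hp]
    refine ⟨hcp, ?_⟩
    have h1 := pderiv_dilation t ht r
    rw [show t r = c⁻¹ by simp [t]] at h1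
    have h2 : dilation K t ht p = p :=
      algHom_congr_of_pderiv_eq_zero (f := (dilation K t ht : _ →ₐ[K] _)) (g := AlgHom.id K _) hp
        fun j hj => by simp [t, hj]
    have h3 := mul_shear_eq hp (dilation K t ht) (inv_ne_zero hc) h1 (by simp [h2, hp])
    simp only [h2, inv_inv] at h3
    rw [eq_mul_inv_of_mul_eq h3.symm]
    have h4 := hH _ (dilation_isAffine t ht)
    exact H.mul_mem (H.mul_mem h4 hp') (H.inv_mem h4)

section shears

variable {H : Subgroup (PolyAut n K)} {hH : ∀ e : PolyAut n K, e.IsAffine → e ∈ H}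
  {r i : Fin n} {p q f : MvPolynomial (Fin n) K}

theorem pderiv_of_mem_shears (hp : p ∈ shears H hH r) : pderiv r p = 0 := hp.1

theorem mem_shears_of_totalDegree_le (hp : pderiv r p = 0) (h : p.totalDegree ≤ 1) :
    p ∈ shears H hH r := ⟨hp, hH _ (shear_isAffine hp h)⟩

/-- Conjugating the shear by `β` gives the shear by `t⁻¹ • β p`. -/
theorem apply_mem_shears {β : PolyAut n K} (hβ : β ∈ H) {t : K} (ht : t ≠ 0)
    (hc : ∀ f, pderiv r (β f) = t • β (pderiv r f)) (hp : p ∈ shears H hH r) :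
    β p ∈ shears H hH r := by
  obtain ⟨hp, hp'⟩ := hp
  have h0 : pderiv r (t⁻¹ • β p) = 0 := by simp [hc, hp]
  have h1 : t⁻¹ • β p ∈ shears H hH r := by
    refine ⟨h0, ?_⟩
    rw [eq_mul_inv_of_mul_eq (mul_shear_eq hp β ht hc h0).symm]
    exact H.mul_mem (H.mul_mem hβ hp') (H.inv_mem hβ)
  simpa [smul_inv_smul₀ ht] using (shears H hH r).smul_mem t h1

/-- The shears `x_i ↦ x_i + c q` commute with `∂_r`, so they preserve the space; differentiate their
action on `f` at `c = 0`. -/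
theorem mul_pderiv_mem_shears (hir : i ≠ r) (hq : q ∈ shears H hH i) (hqr : pderiv r q = 0)
    (hf : f ∈ shears H hH r) : q * pderiv i f ∈ shears H hH r := by
  rw [← mkDerivation_single]
  refine mkDerivation_mem _ _ _ fun c => ?_
  obtain ⟨h0, h1⟩ := (shears H hH i).smul_mem c hq
  have h2 : aeval (R := K) (fun j => X j + C c * (Pi.single i q : Fin n → _) j) f =
      shear i (c • q) h0 f := by
    rw [shear_apply]
    congr 2
    ext1 j
    by_cases hj : j = i
    · subst hj; simp [smul_eq_C_mul]
    · simp [hj]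
  rw [h2]
  refine apply_mem_shears h1 one_ne_zero (pderiv_apply_of_X _ _ _ fun j => ?_) hf
  rw [one_smul]
  by_cases hj : j = i
  · subst hj
    rw [shear_X_self, map_add, pderiv_X_of_ne hir]
    simp [hqr]
  · rw [shear_X_of_ne _ hj]
    by_cases hjr : j = r
    · subst hjr; simp
    · simp [pderiv_X_of_ne hjr]

end shears

end PolyAut

/-! ### Derksen's theorem and triangular automorphisms -/

namespace PolyAut

variable {n : ℕ} {K : Type*} [Field K] [CharZero K]
  {H : Subgroup (PolyAut n K)} {hH : ∀ e : PolyAut n K, e.IsAffine → e ∈ H}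
  {r i j : Fin n} {p q f : MvPolynomial (Fin n) K}

omit [CharZero K] in
theorem dilation_monomial (t : Fin n → K) (ht : ∀ i, t i ≠ 0) (s : Fin n →₀ ℕ) (a : K) :
    dilation K t ht (monomial s a) = monomial s ((s.prod fun j k => t j ^ k) * a) := by
  have h : dilation K t ht (monomial s a) = aeval (fun i => C (t i) * X i) (monomial s a) := rfl
  rw [h, aeval_monomial, monomial_eq (s := s), Finsupp.prod, Finsupp.prod, Finsupp.prod]
  simp only [mul_pow, Finset.prod_mul_distrib, algebraMap_eq, C_mul, map_prod, map_pow]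
  ring

omit [CharZero K] in
theorem coeff_dilation (t : Fin n → K) (ht : ∀ i, t i ≠ 0) (s : Fin n →₀ ℕ)
    (f : MvPolynomial (Fin n) K) :
    coeff s (dilation K t ht f) = (s.prod fun j k => t j ^ k) * coeff s f := by
  induction f using MvPolynomial.induction_on' with
  | monomial m a =>
    rw [dilation_monomial, coeff_monomial, coeff_monomial]
    split_ifs with h
    · rw [h]
    · simp
  | add p q hp hq => rw [map_add, coeff_add, coeff_add, hp, hq, mul_add]

theorem eq_zero_of_pderiv_monomial {m : Fin n →₀ ℕ} (h : pderiv r (monomial m (1 : K)) = 0) :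
    m r = 0 := by
  by_contra h0
  rw [pderiv_monomial, monomial_eq_zero] at h
  simp [h0] at h

/-- The space is stable under diagonal maps. Doubling a variable in which `m` and `m'` have
different exponents, then subtracting `2 ^ m' i` times `f`, removes `m'` and keeps `m`. -/
theorem monomial_mem_shears (hf : f ∈ shears H hH r) {m : Fin n →₀ ℕ} (hm : coeff m f ≠ 0) :
    monomial m 1 ∈ shears H hH r := by
  induction hN : f.support.card using Nat.strong_induction_on generalizing f with
  | _ N ih =>
  by_cases h : ∃ m' ∈ f.support, m' ≠ m
  · obtain ⟨m', hm', hne⟩ := h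
    obtain ⟨i, hi⟩ := DFunLike.ne_iff.1 hne
    let t : Fin n → K := Function.update 1 i 2
    have ht : ∀ j, t j ≠ 0 := fun j => by
      by_cases hj : j = i
      · subst hj; simp [t]
      · simp [t, hj]
    have hprod (s : Fin n →₀ ℕ) : (s.prod fun j k => t j ^ k) = 2 ^ s i := by
      rw [Finsupp.prod_fintype _ _ (by simp), Finset.prod_eq_single i]
      · simp [t]
      · intro j _ hj; simp [t, hj]
      · simp
    have hg : dilation K t ht f - (2 ^ m' i : K) • f ∈ shears H hH r :=
      sub_mem (apply_mem_shears (hH _ (dilation_isAffine t ht)) (ht r) (pderiv_dilation t ht r) hf)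
        (Submodule.smul_mem _ _ hf)
    have hc (s) : coeff s (dilation K t ht f - (2 ^ m' i : K) • f) =
        (2 ^ s i - 2 ^ m' i) * coeff s f := by
      rw [coeff_sub, coeff_smul, coeff_dilation, hprod, smul_eq_mul, sub_mul]
    refine ih _ ?_ hg ?_ rfl
    · rw [← hN]
      refine Finset.card_lt_card (Finset.ssubset_iff_subset_ne.2 ⟨fun s hs => ?_, fun h => ?_⟩)
      · rw [mem_support_iff, hc] at hs
        exact mem_support_iff.2 (right_ne_zero_of_mul hs)
      · rw [← h, mem_support_iff, hc] at hm'
        simp at hm'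
    · rw [hc]
      refine mul_ne_zero (sub_ne_zero.2 fun h => hi ?_) hm
      have : (2 : ℕ) ^ m i = 2 ^ m' i := by exact_mod_cast h
      exact (Nat.pow_right_injective le_rfl this).symm
  · push Not at h
    have : f = monomial m (coeff m f) := by
      ext s
      rw [coeff_monomial]
      split_ifs with hs
      · rw [hs]
      · by_contra hs'
        exact hs (h s (mem_support_iff.2 hs')).symm
    have h2 := (shears H hH r).smul_mem (coeff m f)⁻¹ hf
    rw [this] at h2
    simpa [smul_monomial, hm] using h2

theorem pderiv_mem_shears (hir : i ≠ r) (hf : f ∈ shears H hH r) :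
    pderiv i f ∈ shears H hH r := by
  have h1 : (1 : MvPolynomial (Fin n) K) ∈ shears H hH i :=
    mem_shears_of_totalDegree_le (by simp) (by simp)
  simpa using mul_pderiv_mem_shears hir h1 (by simp) hf

theorem X_mem_shears (h : j ≠ i) : X j ∈ shears H hH i :=
  mem_shears_of_totalDegree_le (pderiv_X_of_ne h) (by simp)

/-- Partial derivatives lower the degree to two, and `x_i ∂_j` turns a mixed product `x_j x_i` into
a square. -/
theorem exists_X_sq_mem_shears_of_monomial {m : Fin n →₀ ℕ} (h2 : 2 ≤ m.degree)
    (hm : monomial m 1 ∈ shears H hH r) : ∃ i, i ≠ r ∧ X i ^ 2 ∈ shears H hH r := by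
  induction hN : m.degree using Nat.strong_induction_on generalizing m with
  | _ N ih =>
  have hmr := eq_zero_of_pderiv_monomial (pderiv_of_mem_shears hm)
  obtain ⟨i, hi⟩ : ∃ i, m i ≠ 0 := by
    by_contra! h
    rw [show m = 0 from Finsupp.ext h] at h2
    simp at h2
  have hir : i ≠ r := by rintro rfl; exact hi hmr
  obtain ⟨m', rfl⟩ : ∃ m', m = m' + Finsupp.single i 1 :=
    ⟨m - Finsupp.single i 1, (tsub_add_cancel_of_le
      (by simpa using Nat.one_le_iff_ne_zero.2 hi)).symm⟩
  rw [map_add, Finsupp.degree_single] at h2 hN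
  rcases h2.lt_or_eq with h2 | h2
  · have h3 := pderiv_mem_shears hir hm
    rw [pderiv_monomial, add_tsub_cancel_right] at h3
    refine ih m'.degree (by omega) (by omega) ?_ rfl
    refine monomial_mem_shears h3 ?_
    rw [coeff_monomial, if_pos rfl, one_mul]
    exact Nat.cast_ne_zero.2 hi
  · obtain ⟨j, rfl⟩ : m' ∈ Set.range fun j : Fin n => Finsupp.single j 1 := by
      rw [Finsupp.range_single_one]
      exact (by omega : m'.degree = 1)
    have h3 : monomial (Finsupp.single j 1 + Finsupp.single i 1) (1 : K) = X j * X i := by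
      simp [X, monomial_mul]
    simp only [h3] at hm
    by_cases hij : j = i
    · subst hij
      exact ⟨j, hir, by rwa [sq]⟩
    · have hjr : j ≠ r := by
        rintro rfl
        simp at hmr
      have h4 := mul_pderiv_mem_shears (i := j) hjr (X_mem_shears (Ne.symm hij))
        (pderiv_X_of_ne hir) hm
      rw [pderiv_mul, pderiv_X_self, pderiv_X_of_ne (Ne.symm hij)] at h4
      exact ⟨i, hir, by simpa [sq] using h4⟩

theorem exists_X_sq_mem_shears (hp : p ∈ shears H hH r) (h : 2 ≤ p.totalDegree) :
    ∃ i, i ≠ r ∧ X i ^ 2 ∈ shears H hH r := by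
  have hs : p.support.Nonempty := by
    rw [Finset.nonempty_iff_ne_empty, Ne, support_eq_empty]
    rintro rfl
    simp at h
  obtain ⟨m, hm, hm'⟩ := Finset.exists_mem_eq_sup p.support hs fun s => s.sum fun _ e => e
  refine exists_X_sq_mem_shears_of_monomial (m := m) (h.trans hm'.le)
    (monomial_mem_shears hp (mem_support_iff.1 hm))

theorem rename_mem_shears (s : Equiv.Perm (Fin n)) (hp : p ∈ shears H hH r) :
    rename s p ∈ shears H hH (s r) := by
  obtain ⟨hp, hp'⟩ := hp
  have h0 : pderiv (s r) (rename s p) = 0 := by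
    rw [pderiv_rename s.injective, hp, map_zero]
  refine ⟨h0, ?_⟩
  have h1 : shear (s r) (rename s p) h0 * perm K s = perm K s * shear r p hp := by
    refine ext_X fun i => ?_
    rw [mul_X, mul_X]
    by_cases hi : i = r
    · subst hi
      simp [perm]
    · rw [shear_X_of_ne _ hi]
      simp only [perm, renameEquiv_apply, rename_X]
      rw [shear_X_of_ne _ (s.injective.ne hi)]
  rw [eq_mul_inv_of_mul_eq h1]
  have h2 := hH _ (perm_isAffine (K := K) s)
  exact H.mul_mem (H.mul_mem h2 hp') (H.inv_mem h2)

theorem X_sq_mem_shears (hir : i ≠ r) (h : X i ^ 2 ∈ shears H hH r) {r' j : Fin n}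
    (hj : j ≠ r') : X j ^ 2 ∈ shears H hH r' := by
  -- The second swap applied moves neither `r'`, so `s` sends `r` to `r'` and `i` to `j` at once.
  let s : Equiv.Perm (Fin n) := Equiv.swap (Equiv.swap r r' i) j * Equiv.swap r r'
  have h1 : Equiv.swap r r' i ≠ r' := fun h => hir <| by
    rw [Equiv.swap_apply_eq_iff, Equiv.swap_apply_right] at h
    exact h
  have hr : s r = r' := by
    simp only [s, Equiv.Perm.mul_apply, Equiv.swap_apply_left]
    exact Equiv.swap_apply_of_ne_of_ne h1.symm hj.symm
  have hi : s i = j := by simp [s]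
  simpa [hr, hi] using rename_mem_shears s h

section

variable (hn : 3 ≤ n) (hsq : ∀ r i : Fin n, i ≠ r → X i ^ 2 ∈ shears H hH r)

include hn hsq

/-- A third variable `x_i` serves as intermediary: apply `x_j^k ∂_i`, then `x_j ∂_i`, to `x_i²` and
get `2 x_j^(k+1)`. This is where `3 ≤ n` enters. -/
theorem X_pow_mem_shears (k : ℕ) (r j : Fin n) (hj : j ≠ r) : X j ^ k ∈ shears H hH r := by
  induction k generalizing r j with
  | zero => exact mem_shears_of_totalDegree_le (by simp) (by simp)
  | succ k ih =>
    obtain ⟨i, hi⟩ : ∃ i, i ∉ ({r, j} : Finset (Fin n)) := by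
      by_contra! h
      have h1 := Finset.card_le_card (fun i _ => h i : Finset.univ ⊆ ({r, j} : Finset (Fin n)))
      have h2 := Finset.card_le_two (a := r) (b := j)
      simp at h1
      omega
    simp only [Finset.mem_insert, Finset.mem_singleton, not_or] at hi
    have h1 := mul_pderiv_mem_shears hi.1 (ih i j (Ne.symm hi.2))
      (pderiv_of_mem_shears (ih r j hj)) (hsq r i hi.1)
    have h2 := mul_pderiv_mem_shears hi.1 (X_mem_shears (Ne.symm hi.2)) (pderiv_X_of_ne hj) h1
    have h3 : (X j : MvPolynomial (Fin n) K) * pderiv i (X j ^ k * pderiv i (X i ^ 2)) =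
        (2 : K) • X j ^ (k + 1) := by
      rw [show pderiv i (X i ^ 2) = C 2 * (X i : MvPolynomial (Fin n) K) by
        rw [pderiv_pow, pderiv_X_self, map_ofNat]; simp]
      simp [pderiv_X_of_ne (Ne.symm hi.2), smul_eq_C_mul]
      ring
    rw [h3] at h2
    exact ((shears H hH r).smul_mem_iff two_ne_zero).1 h2

/-- For `m` free of `x_i`, the operator `m ∂_i` sends `x_i^(b+1)` to `(b+1) x_i^b m`; this adds one
variable at a time. -/
theorem monomial_mem_shears_of_X_sq (m : Fin n →₀ ℕ) (r : Fin n) (hm : m r = 0) :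
    monomial m 1 ∈ shears H hH r := by
  induction m using Finsupp.induction generalizing r with
  | zero =>
    have h : monomial (0 : Fin n →₀ ℕ) (1 : K) = 1 := rfl
    exact mem_shears_of_totalDegree_le (by simp [h]) (by simp [h])
  | single_add i b m him hb ih =>
    have hir : i ≠ r := by
      rintro rfl
      simp [hb] at hm
    have hmr : m r = 0 := by simpa [hir] using hm
    have h1 := mul_pderiv_mem_shears hir (ih i (by simpa using him))
      (pderiv_of_mem_shears (ih r hmr)) (X_pow_mem_shears hn hsq (b + 1) r i hir)
    have h2 : monomial m (1 : K) * pderiv i (X i ^ (b + 1)) =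
        ((b + 1 : ℕ) : K) • monomial (Finsupp.single i b + m) 1 := by
      rw [pderiv_pow, pderiv_X_self, add_tsub_cancel_right, mul_one, monomial_single_add,
        smul_eq_C_mul, map_natCast]
      ring
    rw [h2] at h1
    exact ((shears H hH r).smul_mem_iff (Nat.cast_ne_zero.2 b.succ_ne_zero)).1 h1

theorem mem_shears_of_X_sq (hp : pderiv r p = 0) : p ∈ shears H hH r := by
  rw [p.as_sum]
  refine sum_mem fun m hm => ?_
  have h1 : m r = 0 := by
    by_contra h
    exact vars_of_pderiv_eq_zero hp ((mem_vars_iff_mem_support r).2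
      ⟨m, hm, Finsupp.mem_support_iff.2 h⟩)
  have h2 := (shears H hH r).smul_mem (coeff m p) (monomial_mem_shears_of_X_sq hn hsq m r h1)
  simpa [smul_monomial] using h2

end

/-- Derksen's theorem: a nonaffine shear together with the affine automorphisms generates all
shears. -/
theorem mem_shears_of_two_le (hn : 3 ≤ n) (hp : p ∈ shears H hH r) (h : 2 ≤ p.totalDegree)
    {s : Fin n} (hq : pderiv s q = 0) : q ∈ shears H hH s := by
  obtain ⟨i, hi, hsq⟩ := exists_X_sq_mem_shears hp h
  exact mem_shears_of_X_sq hn (fun _ _ hj => X_sq_mem_shears hi hsq hj) hq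

/-- Induction on the number `k` of initial variables that may move, splitting off the last of them.
-/
theorem triangular_mem (hs : ∀ (r : Fin n) q, pderiv r q = 0 → q ∈ shears H hH r)
    (k : ℕ) (e : PolyAut n K)
    (he : ∀ i, ∃ u : Kˣ, ∃ P ∈ supported K (Set.Iio i), e (X i) = C (u : K) * X i + P)
    (hk : ∀ i : Fin n, k ≤ i → e (X i) = X i) : e ∈ H := by
  induction k generalizing e with
  | zero =>
    rw [show e = 1 from ext_X fun i => hk i (Nat.zero_le _)]
    exact H.one_mem
  | succ k ih =>
    by_cases hkn : n ≤ k
    · exact ih e he fun i hi => absurd i.2 (by omega)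
    let r : Fin n := ⟨k, not_le.1 hkn⟩
    obtain ⟨u, P, hP, hr⟩ := he r
    have hsupp {Q : MvPolynomial (Fin n) K} {s : Set (Fin n)} (hrs : r ∉ s)
        (h : Q ∈ supported K s) : pderiv r Q = 0 :=
      pderiv_eq_zero_of_notMem_vars fun h' => hrs (mem_supported.1 h h')
    have hPr : pderiv r P = 0 := hsupp (by simp) hP
    let t : Fin n → K := Function.update 1 r u
    have ht : ∀ j, t j ≠ 0 := fun j => by
      by_cases hj : j = r
      · subst hj; simp [t]
      · simp [t, hj]
    have h0 : pderiv r ((u : K)⁻¹ • P) = 0 := by simp [hPr]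
    -- `g` agrees with `e` on `x_r` and fixes everything free of `x_r`, so `g⁻¹ * e` is triangular
    -- and also fixes `x_r`.
    let g : PolyAut n K := shear r _ h0 * dilation K t ht
    have hg : g ∈ H := H.mul_mem (hs r _ h0).2 (hH _ (dilation_isAffine t ht))
    have hgr : g (X r) = e (X r) := by
      rw [hr, mul_X, dilation_X, ← smul_eq_C_mul, map_smul, shear_X_self, smul_add,
        smul_eq_C_mul]
      simp [t]
    have hgi {i : Fin n} (hi : i ≠ r) : g (X i) = X i := by
      simp [g, t, hi, shear_X_of_ne]
    have hgQ {Q : MvPolynomial (Fin n) K} (hQ : pderiv r Q = 0) : g⁻¹ Q = Q := by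
      have : g Q = Q := algHom_congr_of_pderiv_eq_zero
        (f := (g : MvPolynomial (Fin n) K →ₐ[K] _)) (g := AlgHom.id K _) hQ fun j hj => hgi hj
      exact (AlgEquiv.symm_apply_eq g).2 this.symm
    have hmem : g⁻¹ * e ∈ H := by
      refine ih _ (fun i => ?_) fun i hi => ?_
      · rcases lt_trichotomy i r with hir | hir | hir
        · obtain ⟨v, Q, hQ, hi⟩ := he i
          refine ⟨v, Q, hQ, ?_⟩
          rw [mul_X, hi]
          refine hgQ ?_
          rw [map_add, hsupp (by simpa using hir.le) hQ, pderiv_C_mul, pderiv_X_of_ne hir.ne]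
          simp
        · subst hir
          refine ⟨1, 0, zero_mem _, ?_⟩
          rw [mul_X, ← hgr]
          exact (g.symm_apply_apply _).trans (by simp)
        · refine ⟨1, 0, zero_mem _, ?_⟩
          rw [mul_X, hk i hir, hgQ (pderiv_X_of_ne hir.ne')]
          simp
      · rcases hi.eq_or_lt with hi | hi
        · obtain rfl : r = i := Fin.ext hi
          rw [mul_X, ← hgr]
          exact g.symm_apply_apply _
        · rw [mul_X, hk i hi, hgQ (pderiv_X_of_ne (by rintro rfl; exact hi.ne rfl))]
    simpa using H.mul_mem hg hmem

end PolyAut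

/-! ### Affine automorphisms and constant derivations -/

namespace PolyAut

variable {n : ℕ} {K : Type*} [Field K]

section affine

theorem IsAffine.totalDegree_apply_le {e : PolyAut n K} (he : e.IsAffine)
    {p : MvPolynomial (Fin n) K} (hp : p.totalDegree ≤ 1) : (e p).totalDegree ≤ 1 := by
  rw [eq_C_add_sum_of_totalDegree_le_one hp, map_add, map_sum]
  refine (totalDegree_add _ _).trans (max_le ?_ (totalDegree_finsetSum_le fun i _ => ?_))
  · rw [show e (C (coeff 0 p)) = C (coeff 0 p) from e.commutes _]
    simp
  · rw [← smul_eq_C_mul, map_smul]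
    exact (totalDegree_smul_le _ _).trans (he i)

theorem IsAffine.mul {e f : PolyAut n K} (he : e.IsAffine) (hf : f.IsAffine) :
    (e * f).IsAffine := fun i => he.totalDegree_apply_le (hf i)

/-- `e` is injective on the finite-dimensional space of polynomials of degree at most one, hence
surjective there. -/
theorem IsAffine.inv {e : PolyAut n K} (he : e.IsAffine) : e⁻¹.IsAffine := by
  let V := restrictTotalDegree (Fin n) K 1
  have hV (p) : p ∈ V ↔ p.totalDegree ≤ 1 := mem_restrictTotalDegree _ _ _
  let l : V →ₗ[K] V := (e.toLinearMap).restrict (p := V) (q := V) fun p hp =>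
    (hV _).2 (he.totalDegree_apply_le ((hV p).1 hp))
  have hl : Function.Injective l := fun p q h =>
    Subtype.ext (e.injective (congrArg Subtype.val h))
  intro i
  obtain ⟨p, hp⟩ := LinearMap.injective_iff_surjective.1 hl ⟨X i, (hV _).2 (by simp)⟩
  have h1 : e p.1 = X i := congrArg Subtype.val hp
  rw [← h1]
  exact (congrArg totalDegree (e.symm_apply_apply p.1)).trans_le ((hV _).1 p.2)

end affine

section dirDeriv

/-- The derivative in the direction of a vector. -/
def dirDeriv (v : Fin n → K) : Derivation K (MvPolynomial (Fin n) K) (MvPolynomial (Fin n) K) :=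
  mkDerivation K fun i => C (v i)

@[simp]
theorem dirDeriv_X (v : Fin n → K) (i : Fin n) : dirDeriv v (X i) = C (v i) :=
  mkDerivation_X _ _ _

/-- The conjugate of a derivation by an automorphism. -/
def conj (e : PolyAut n K)
    (D : Derivation K (MvPolynomial (Fin n) K) (MvPolynomial (Fin n) K)) :
    Derivation K (MvPolynomial (Fin n) K) (MvPolynomial (Fin n) K) :=
  Derivation.mk' (e.toLinearMap ∘ₗ D.toLinearMap ∘ₗ e.symm.toLinearMap) fun a b => by simp

theorem conj_apply (e : PolyAut n K)
    (D : Derivation K (MvPolynomial (Fin n) K) (MvPolynomial (Fin n) K))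
    (f : MvPolynomial (Fin n) K) : conj e D f = e (D (e.symm f)) := rfl

/-- The constant derivations are conjugate to partial derivatives by affine automorphisms. -/
theorem exists_isAffine_dirDeriv {v : Fin n → K} (hv : v ≠ 0) (r : Fin n) :
    ∃ γ : PolyAut n K, γ.IsAffine ∧ ∀ f, dirDeriv v (γ f) = γ (pderiv r f) := by
  obtain ⟨k, hk⟩ := Function.ne_iff.1 hv
  rw [Pi.zero_apply] at hk
  -- For `i ≠ r` the index `s i` runs over all indices but `k`; the components are `x_k / v_k`, of
  -- derivative one, and functions killed by `∂_v`.
  let s := Equiv.swap r k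
  let g : Fin n → MvPolynomial (Fin n) K := fun i =>
    if i = r then C (v k)⁻¹ * X k else X (s i) - C (v (s i) / v k) * X k
  have hg : ∀ i, X i ∈ (aeval (R := K) g).range := fun i => by
    by_cases hi : i = k
    · subst hi
      refine ⟨C (v i) * X r, ?_⟩
      simp [g, ← mul_assoc, ← C_mul, hk]
    · have hs : s i ≠ r := fun h => hi <| by
        rwa [Equiv.swap_apply_eq_iff, Equiv.swap_apply_left] at h
      refine ⟨X (s i) + C (v i) * X r, ?_⟩
      have h1 : s (s i) = i := Equiv.swap_apply_self _ _ _
      change aeval (R := K) g _ = _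
      simp only [map_add, map_mul, aeval_X, g, hs, if_false, if_true, algHom_C, algebraMap_eq]
      rw [h1, ← mul_assoc, ← C_mul, div_eq_mul_inv, sub_add_cancel]
  refine ⟨ofSurjective g hg, fun i => ?_, fun f => ?_⟩
  · rw [ofSurjective_X]
    by_cases hi : i = r
    · simp only [g, hi, if_true]
      exact (totalDegree_mul _ _).trans (by simp)
    · simp only [g, hi, if_false]
      exact (totalDegree_sub _ _).trans (max_le (by simp)
        ((totalDegree_mul _ _).trans (by simp)))
  · refine derivation_algHom_comm (D := dirDeriv v) (D' := pderiv r)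
      (β := (ofSurjective g hg : MvPolynomial (Fin n) K →ₐ[K] MvPolynomial (Fin n) K))
      (fun i => ?_) f
    change dirDeriv v (ofSurjective g hg (X i)) = ofSurjective g hg (pderiv r (X i))
    rw [ofSurjective_X]
    by_cases hi : i = r
    · subst hi
      simp [g, ← C_mul, hk]
    · simp only [g, hi, if_false]
      rw [pderiv_X_of_ne hi, map_zero, map_sub, Derivation.leibniz, dirDeriv_X, dirDeriv_X,
        derivation_C, smul_zero, add_zero, smul_eq_mul, ← C_mul, div_mul_cancel₀ _ hk, sub_self]

theorem dirDeriv_eq_sum (v : Fin n → K) {p : MvPolynomial (Fin n) K} (hp : p.totalDegree ≤ 1) :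
    dirDeriv v p = ∑ i, coeff (Finsupp.single i 1) p • C (v i) := by
  conv_lhs => rw [eq_C_add_sum_of_totalDegree_le_one hp]
  simp only [map_add, map_sum, derivation_C, zero_add, ← smul_eq_C_mul, Derivation.map_smul,
    dirDeriv_X]

/-- Used to turn functionals vanishing on the image of `D` into constant derivations commuting with
`D`. -/
theorem dirDeriv_of_totalDegree_le_one (l : MvPolynomial (Fin n) K →ₗ[K] K) (h1 : l 1 = 0)
    {p : MvPolynomial (Fin n) K} (hp : p.totalDegree ≤ 1) :
    dirDeriv (fun i => l (X i)) p = C (l p) := by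
  have hC (a : K) : l (C a) = 0 := by
    rw [← mul_one (C a), ← smul_eq_C_mul, map_smul, h1, smul_zero]
  rw [dirDeriv_eq_sum _ hp]
  conv_rhs => rw [eq_C_add_sum_of_totalDegree_le_one hp]
  simp only [map_add, map_sum, zero_add, hC, ← smul_eq_C_mul, map_smul, smul_eq_mul, C_mul]

theorem sum_derivation_apply {ι : Type*} (s : Finset ι)
    (D : ι → Derivation K (MvPolynomial (Fin n) K) (MvPolynomial (Fin n) K))
    (f : MvPolynomial (Fin n) K) : (∑ i ∈ s, D i) f = ∑ i ∈ s, D i f := by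
  rw [← Finset.sum_apply]
  exact congrFun (map_sum Derivation.coeFnAddMonoidHom D s) f

theorem totalDegree_dirDeriv_le (v : Fin n → K) (p : MvPolynomial (Fin n) K) :
    (dirDeriv v p).totalDegree ≤ p.totalDegree - 1 := by
  have h : dirDeriv v = ∑ i, v i • pderiv (R := K) i := by
    refine derivation_ext fun j => ?_
    rw [dirDeriv_X, sum_derivation_apply, Finset.sum_eq_single j]
    · simp [smul_eq_C_mul]
    · intro i _ hi
      simp [pderiv_X_of_ne hi.symm]
    · simp
  rw [h, sum_derivation_apply]
  exact totalDegree_finsetSum_le fun i _ =>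
    (totalDegree_smul_le _ _).trans (totalDegree_pderiv_le i p)

theorem dirDeriv_comm {v : Fin n → K}
    {D : Derivation K (MvPolynomial (Fin n) K) (MvPolynomial (Fin n) K)}
    (h : ∀ i, dirDeriv v (D (X i)) = 0) (f : MvPolynomial (Fin n) K) :
    dirDeriv v (D f) = D (dirDeriv v f) := by
  have h0 : ⁅dirDeriv v, D⁆ = 0 := derivation_ext fun i => by
    rw [Derivation.commutator_apply, h, dirDeriv_X, derivation_C, sub_zero, Derivation.zero_apply]
  have h1 := congrArg (fun E => E f) h0
  simp only [Derivation.commutator_apply, Derivation.zero_apply] at h1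
  exact sub_eq_zero.1 h1

end dirDeriv

/-! ### Rigidity when all shears of the group are affine -/

section rigid

variable [CharZero K] {H : Subgroup (PolyAut n K)} {hH : ∀ e : PolyAut n K, e.IsAffine → e ∈ H}

theorem derivation_shear {r : Fin n} {p : MvPolynomial (Fin n) K} (hp : pderiv r p = 0)
    {D : Derivation K (MvPolynomial (Fin n) K) (MvPolynomial (Fin n) K)}
    (hD : ∀ i, pderiv r (D (X i)) = 0) (hDp : D p = 0) (f : MvPolynomial (Fin n) K) :
    D (shear r p hp f) = shear r p hp (D f) := by
  refine derivation_algHom_comm (D := D) (D' := D)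
    (β := (shear r p hp : MvPolynomial (Fin n) K →ₐ[K] MvPolynomial (Fin n) K)) (fun i => ?_) f
  change D (shear r p hp (X i)) = shear r p hp (D (X i))
  rw [shear_apply_of_pderiv_eq_zero hp (hD i)]
  by_cases hi : i = r
  · subst hi
    rw [shear_X_self, map_add, hDp, add_zero]
  · rw [shear_X_of_ne hp hi]

/-- An automorphism of the group normalising a group of coordinate translations is affine, unless
the group contains a nonaffine shear. -/
theorem isAffine_of_pderiv_comm (hR : ∀ r, ∀ p ∈ shears H hH r, p.totalDegree ≤ 1)
    {β : PolyAut n K} (hβ : β ∈ H) {r : Fin n} {t : K} (ht : t ≠ 0)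
    (hc : ∀ f, pderiv r (β f) = t • β (pderiv r f)) : β.IsAffine := by
  have h1 {j : Fin n} (hj : j ≠ r) : (β (X j)).totalDegree ≤ 1 :=
    hR r _ (apply_mem_shears hβ ht hc (X_mem_shears hj))
  -- Thus `β x_r = t (x_r + q)`. Removing the shear by `q` leaves an affine map, so that shear lies
  -- in `H` and is itself affine.
  let q := t⁻¹ • (β (X r) - t • X r)
  have hq : pderiv r q = 0 := by simp [q, hc]
  have hr : β (X r) = t • shear r q hq (X r) := by
    rw [shear_X_self, smul_add, smul_inv_smul₀ ht]
    ring
  have h2 : ((shear r q hq)⁻¹ * β).IsAffine := fun j => by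
    by_cases hj : j = r
    · subst hj
      rw [mul_X, hr, map_smul]
      refine (totalDegree_smul_le _ _).trans ?_
      exact (congrArg totalDegree ((shear j q hq).symm_apply_apply _)).trans_le (by simp)
    · have h3 : (shear r q hq)⁻¹ (β (X j)) = β (X j) := by
        refine (AlgEquiv.symm_apply_eq (shear r q hq)).2
          (shear_apply_of_pderiv_eq_zero hq ?_).symm
        simp [hc, pderiv_X_of_ne hj]
      rw [mul_X, h3]
      exact h1 hj
  have h3 : shear r q hq ∈ H := by
    have := H.mul_mem hβ (H.inv_mem (hH _ h2))
    simpa using this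
  have h4 := shear_isAffine hq (hR r q ⟨hq, h3⟩)
  simpa using h4.mul h2

theorem isAffine_of_dirDeriv_comm (hR : ∀ r, ∀ p ∈ shears H hH r, p.totalDegree ≤ 1)
    {η : PolyAut n K} (hη : η ∈ H) {v : Fin n → K} (hv : v ≠ 0) {r : Fin n}
    (hc : ∀ f, dirDeriv v (η f) = η (dirDeriv v f)) : η.IsAffine := by
  obtain ⟨γ, hγ, hγ'⟩ := exists_isAffine_dirDeriv hv r
  have h1 : (γ⁻¹ * η * γ).IsAffine := by
    refine isAffine_of_pderiv_comm hR (r := r)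
      (H.mul_mem (H.mul_mem (H.inv_mem (hH _ hγ)) hη) (hH _ hγ)) one_ne_zero fun f => ?_
    apply γ.injective
    rw [← hγ', one_smul]
    have h2 (g) : γ ((γ⁻¹ * η * γ) g) = η (γ g) := γ.apply_symm_apply _
    rw [h2, h2, hc, hγ']
  have h2 := (hγ.mul h1).mul hγ.inv
  simpa [mul_assoc] using h2

variable {φ : PolyAut n K} (hφ : φ ∈ H) {r : Fin n}
  {D : Derivation K (MvPolynomial (Fin n) K) (MvPolynomial (Fin n) K)}
  (hD : ∀ f, D (φ f) = φ (pderiv r f))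

include hφ hD

/-- Since `D = φ ∂_r φ⁻¹`, the conjugate `φ⁻¹ α φ` scales `∂_r` as `α` scales `D`. -/
theorem symm_apply_mem_shears {α : PolyAut n K} (hα : α ∈ H) {t : K} (ht : t ≠ 0)
    (hc : ∀ f, D (α f) = t • α (D f)) {f : MvPolynomial (Fin n) K}
    (hf : φ.symm f ∈ shears H hH r) : φ.symm (α f) ∈ shears H hH r := by
  have h1 : (φ⁻¹ * α * φ) (φ.symm f) ∈ shears H hH r := by
    refine apply_mem_shears (H.mul_mem (H.mul_mem (H.inv_mem hφ) hα) hφ) ht (fun g => ?_) hf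
    apply φ.injective
    have h2 (g) : φ ((φ⁻¹ * α * φ) g) = α (φ g) := φ.apply_symm_apply _
    rw [← hD, map_smul, h2, h2, hc, hD]
  have h2 : (φ⁻¹ * α * φ) (φ.symm f) = φ.symm (α f) := by
    change φ.symm (α (φ (φ.symm f))) = _
    rw [φ.apply_symm_apply]
  rwa [h2] at h1

/-- The polynomials obtained from the shears are stable under the constant derivations commuting
with the derivation. -/
theorem dirDeriv_mem (hDX : ∀ i, (D (X i)).totalDegree ≤ 1) {v : Fin n → K}
    (hv : ∀ i, dirDeriv v (D (X i)) = 0) {f : MvPolynomial (Fin n) K}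
    (hf : φ.symm f ∈ shears H hH r) : φ.symm (dirDeriv v f) ∈ shears H hH r := by
  refine mkDerivation_mem ((shears H hH r).comap φ.symm.toLinearMap) _ _ fun c => ?_
  let g (a : K) : Fin n → MvPolynomial (Fin n) K := fun i => X i + C a * C (v i)
  have hg (a : K) (i : Fin n) : X i ∈ (aeval (R := K) (g a)).range :=
    ⟨X i - C a * C (v i), by simp [g, algebraMap_eq]⟩
  have h1 : (ofSurjective (g c) (hg c)).IsAffine := fun i => by
    rw [ofSurjective_X]
    exact (totalDegree_add _ _).trans (max_le (by simp) (by rw [← C_mul, totalDegree_C]; exact zero_le_one))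
  refine symm_apply_mem_shears (α := ofSurjective (g c) (hg c)) hφ hD (hH _ h1) one_ne_zero
    (fun f => ?_) hf
  rw [one_smul]
  refine derivation_algHom_comm (D := D) (D' := D) (β := aeval (R := K) (g c)) (fun i => ?_) f
  -- An affine function with zero derivative along `v` is invariant under translation by `c v`;
  -- applied to `D x_i`.
  have h2 {p : MvPolynomial (Fin n) K} (hp : p.totalDegree ≤ 1) (hp' : dirDeriv v p = 0) :
      aeval (R := K) (g c) p = p := by
    rw [dirDeriv_eq_sum _ hp] at hp'
    rw [eq_C_add_sum_of_totalDegree_le_one hp]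
    simp only [map_add, map_sum, map_mul, aeval_X, algHom_C, algebraMap_eq, g, mul_add,
      Finset.sum_add_distrib]
    have h3 : ∑ i, C (coeff (Finsupp.single i 1) p) * (C c * C (v i)) =
        C c * ∑ i, coeff (Finsupp.single i 1) p • (C (v i) : MvPolynomial (Fin n) K) := by
      rw [Finset.mul_sum]
      refine Finset.sum_congr rfl fun i _ => ?_
      rw [smul_eq_C_mul]
      ring
    rw [h3, hp', mul_zero, add_zero]
  rw [h2 (hDX i) (hv i), aeval_X]
  rw [map_add, ← C_mul, derivation_C, add_zero]

/-- If the group contains no nonaffine shear, the polynomials obtained from the shears that are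
killed by a constant derivation commuting with the derivation are constant. -/
theorem totalDegree_eq_zero_of_dirDeriv_eq_zero
    (hR : ∀ r, ∀ p ∈ shears H hH r, p.totalDegree ≤ 1)
    (hDX : ∃ i, (D (X i)).totalDegree ≠ 0) {v : Fin n → K} (hv0 : v ≠ 0)
    (hv : ∀ i, dirDeriv v (D (X i)) = 0) {f : MvPolynomial (Fin n) K}
    (hf : φ.symm f ∈ shears H hH r) (hvf : dirDeriv v f = 0) : f.totalDegree = 0 := by
  by_contra hf0
  obtain ⟨i, hi⟩ := hDX
  have hcomm := dirDeriv_comm hv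
  -- This element is `f * D x_i`, the derivative at `c = 0` of `exp(c f D) x_i`; the exponential is
  -- `φ` conjugating a shear.
  have h1 : φ (φ.symm f * pderiv r (φ.symm (X i))) ∈ restrictTotalDegree (Fin n) K 1 := by
    rw [← mkDerivation_single]
    refine mkDerivation_mem ((restrictTotalDegree (Fin n) K 1).comap φ.toLinearMap) _ _
      fun c => ?_
    obtain ⟨h0, h1⟩ := (shears H hH r).smul_mem c hf
    have h2 : aeval (R := K) (fun j => X j + C c * (Pi.single r (φ.symm f) : Fin n → _) j)
        (φ.symm (X i)) = shear r (c • φ.symm f) h0 (φ.symm (X i)) := by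
      rw [shear_apply]
      congr 2
      ext1 j
      by_cases hj : j = r
      · subst hj; simp [smul_eq_C_mul]
      · simp [hj]
    rw [h2]
    refine (mem_restrictTotalDegree _ _ _).2 ?_
    refine isAffine_of_dirDeriv_comm hR (η := φ * shear r (c • φ.symm f) h0 * φ⁻¹)
      (H.mul_mem (H.mul_mem hφ h1) (H.inv_mem hφ)) hv0 (r := r) (fun g => ?_) i
    let Δ := conj φ.symm (dirDeriv v)
    have hΔ (j : Fin n) : pderiv r (Δ (X j)) = 0 := by
      apply φ.injective
      rw [← hD]
      change D (φ (φ.symm (dirDeriv v (φ (X j))))) = _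
      rw [φ.apply_symm_apply, ← hcomm, hD, map_zero]
      by_cases hj : j = r
      · subst hj; simp
      · simp [pderiv_X_of_ne hj]
    have hΔf : Δ (c • φ.symm f) = 0 := by
      rw [Derivation.map_smul]
      change c • φ.symm (dirDeriv v (φ (φ.symm f))) = 0
      rw [φ.apply_symm_apply, hvf, map_zero, smul_zero]
    have h4 := congrArg φ (derivation_shear h0 hΔ hΔf (φ.symm g))
    change φ (φ.symm (dirDeriv v (φ (shear r (c • φ.symm f) h0 (φ.symm g))))) =
      φ (shear r (c • φ.symm f) h0 (φ.symm (dirDeriv v (φ (φ.symm g))))) at h4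
    rw [φ.apply_symm_apply, φ.apply_symm_apply] at h4
    exact h4
  rw [map_mul, ← hD, φ.apply_symm_apply, φ.apply_symm_apply, mem_restrictTotalDegree] at h1
  rw [totalDegree_mul_of_isDomain] at h1
  · omega
  · rintro rfl; simp at hf0
  · intro h; simp [h] at hi

end rigid

end PolyAut

/-! ### The constant case and the regular nilpotent case -/

namespace PolyAut

variable {n : ℕ} {K : Type*} [Field K] [CharZero K]
  {H : Subgroup (PolyAut n K)} {hH : ∀ e : PolyAut n K, e.IsAffine → e ∈ H}
  {φ : PolyAut n K} {r : Fin n}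
  {D : Derivation K (MvPolynomial (Fin n) K) (MvPolynomial (Fin n) K)}

theorem isAffine_of_totalDegree_eq_zero (hR : ∀ r, ∀ p ∈ shears H hH r, p.totalDegree ≤ 1)
    (hφ : φ ∈ H) (hD : ∀ f, D (φ f) = φ (pderiv r f))
    (h0 : ∀ i, (D (X i)).totalDegree = 0) : φ.IsAffine := by
  let v : Fin n → K := fun i => coeff 0 (D (X i))
  have hDv : D = dirDeriv v := derivation_ext fun i => by
    rw [dirDeriv_X]
    exact totalDegree_eq_zero_iff_eq_C.1 (h0 i)
  have hv : v ≠ 0 := by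
    intro hv
    have h1 : D (φ (X r)) = 0 := by
      rw [hDv, show dirDeriv v = 0 from derivation_ext fun i => by simp [hv]]
      rfl
    simp [hD] at h1
  obtain ⟨γ, hγ, hγ'⟩ := exists_isAffine_dirDeriv hv r
  have h1 : (γ⁻¹ * φ).IsAffine := by
    refine isAffine_of_pderiv_comm hR (r := r) (H.mul_mem (H.inv_mem (hH _ hγ)) hφ)
      one_ne_zero fun f => ?_
    apply γ.injective
    have h2 (g) : γ ((γ⁻¹ * φ) g) = φ g := γ.apply_symm_apply _
    rw [← hγ', one_smul, h2, h2, ← hDv, hD]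
  simpa using hγ.mul h1

section weight

/-- The weight of the variable `x_i` is `i + 1`, counting from zero. -/
def wt (i : Fin n) : ℕ := i + 1

/-- The dilation multiplies the component of weight `d` by `t ^ d`, so the components are
coefficients of a polynomial in `t`. -/
theorem weightedHomogeneousComponent_mem (S : Submodule K (MvPolynomial (Fin n) K))
    {f : MvPolynomial (Fin n) K}
    (h : ∀ (t : K) (ht : t ≠ 0), dilation K (fun i => t ^ wt i) (fun _ => pow_ne_zero _ ht) f ∈ S)
    (d : ℕ) : weightedHomogeneousComponent wt d f ∈ S := by
  let R : Polynomial (MvPolynomial (Fin n) K) := ∑ m ∈ f.support,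
    Polynomial.monomial (Finsupp.weight wt m) (monomial m (coeff m f))
  have hR : R.coeff d = weightedHomogeneousComponent wt d f := by
    rw [weightedHomogeneousComponent_apply, Finset.sum_filter]
    simp [R, Polynomial.finsetSum_coeff, Polynomial.coeff_monomial]
  rw [← hR]
  refine Polynomial.coeff_mem_of_eval_mem S R (fun t ht => ?_) d
  convert h t ht using 1
  conv_rhs => rw [f.as_sum, map_sum]
  rw [Polynomial.eval_finsetSum]
  refine Finset.sum_congr rfl fun m _ => ?_
  have h1 : (m.prod fun j k => (t ^ wt j) ^ k) = t ^ Finsupp.weight wt m := by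
    rw [Finsupp.weight_apply, Finsupp.sum, ← Finset.prod_pow_eq_pow_sum]
    refine Finset.prod_congr rfl fun j _ => ?_
    change (t ^ wt j) ^ m j = _
    rw [← pow_mul, smul_eq_mul, mul_comm (m j)]
  rw [Polynomial.eval_monomial, dilation_monomial, h1, algebraMap_eq, ← C_pow, mul_comm,
    C_mul_monomial]

/-- The regular nilpotent case: if `D x_0 = 1` and `D x_i = x_{i - 1}` for `i > 0`, then the group
contains a nonaffine shear. -/
theorem false_of_regular (hn : 3 ≤ n) (hR : ∀ r, ∀ p ∈ shears H hH r, p.totalDegree ≤ 1)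
    (hφ : φ ∈ H) (hD : ∀ f, D (φ f) = φ (pderiv r f))
    (hD0 : ∀ i : Fin n, (i : ℕ) = 0 → D (X i) = 1)
    (hDX : ∀ i j : Fin n, (i : ℕ) = j + 1 → D (X i) = X j) : False := by
  have hDX' (i : Fin n) : D (X i) = 1 ∨ ∃ j : Fin n, (i : ℕ) = j + 1 ∧ D (X i) = X j := by
    rcases Nat.eq_zero_or_pos (i : ℕ) with h | h
    · exact Or.inl (hD0 i h)
    · exact Or.inr ⟨⟨i - 1, by omega⟩, by simp; omega, hDX _ _ (by simp; omega)⟩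
  let z : Fin n := ⟨n - 1, by omega⟩
  let v : Fin n → K := Pi.single z 1
  have hvz : dirDeriv v = pderiv z := derivation_ext fun i => by
    by_cases hi : i = z
    · subst hi; simp [v]
    · simp [v, hi, pderiv_X_of_ne hi]
  have hv0 : v ≠ 0 := by simp [v]
  have hle (i : Fin n) : (D (X i)).totalDegree ≤ 1 := by
    rcases hDX' i with h | ⟨j, _, h⟩ <;> simp [h]
  have hne : ∃ i, (D (X i)).totalDegree ≠ 0 :=
    ⟨⟨1, by omega⟩, by rw [hDX ⟨1, by omega⟩ ⟨0, by omega⟩ rfl]; simp⟩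
  have hv (i : Fin n) : dirDeriv v (D (X i)) = 0 := by
    rcases hDX' i with h | ⟨j, hj, h⟩
    · simp [h]
    · rw [h, hvz, pderiv_X_of_ne]
      rintro rfl
      have := i.2
      simp [z] at hj
      omega
  let W := (shears H hH r).comap φ.symm.toLinearMap
  have hWt {f} (hf : f ∈ W) (d : ℕ) : weightedHomogeneousComponent wt d f ∈ W := by
    refine weightedHomogeneousComponent_mem W (fun t ht => ?_) d
    refine symm_apply_mem_shears (hH := hH) hφ hD (hH _ (dilation_isAffine _ _)) ht (fun g => ?_) hf
    rw [← map_smul]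
    refine derivation_algHom_comm (D := D) (D' := t • D)
      (β := (dilation K (fun i : Fin n => t ^ wt i) (fun _ => pow_ne_zero _ ht) :
        MvPolynomial (Fin n) K →ₐ[K] MvPolynomial (Fin n) K)) (fun i => ?_) g
    change D (dilation K _ _ (X i)) = dilation K _ _ (t • D (X i))
    rw [dilation_X, ← smul_eq_C_mul, Derivation.map_smul]
    rcases Nat.eq_zero_or_pos (i : ℕ) with h | h
    · rw [hD0 i h, map_smul, map_one, wt, h, zero_add, pow_one]
    · have hi := hDX i ⟨i - 1, by omega⟩ (by simp; omega)
      rw [hi, map_smul, dilation_X, ← smul_eq_C_mul, smul_smul, ← pow_succ']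
      congr 2
      simp [wt]
      omega
  -- `∂_z` preserves `W`, lowers the weight by `wt z = n`, and kills only constants in `W`.
  have hdvd (d : ℕ) : ∀ f ∈ W, IsWeightedHomogeneous wt f d → f ≠ 0 → n ∣ d := by
    induction d using Nat.strong_induction_on with
    | _ d ih =>
    intro f hf hfd hf0
    by_cases hz : pderiv z f = 0
    · have h1 := totalDegree_eq_zero_of_dirDeriv_eq_zero hφ hD hR hne hv0 hv hf (by rwa [hvz])
      have h2 : coeff 0 f ≠ 0 := by
        intro h
        rw [totalDegree_eq_zero_iff_eq_C.1 h1, h, C_0] at hf0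
        exact hf0 rfl
      rw [← hfd h2, map_zero]
      exact dvd_zero n
    · obtain ⟨m, hm⟩ := ne_zero_iff.1 hz
      rw [coeff_pderiv] at hm
      have h1 := hfd (left_ne_zero_of_mul hm)
      rw [map_add, Finsupp.weight_single, one_smul] at h1
      have hwz : wt z = n := by simp [wt, z]; omega
      have h2 := ih (Finsupp.weight wt m) (by omega) (pderiv z f)
        (by rw [← hvz]; exact dirDeriv_mem (hH := hH) hφ hD hle hv hf) (hfd.pderiv h1) hz
      rw [← h1, hwz]
      exact dvd_add h2 dvd_rfl
  let w' : Fin n → ZMod n := fun i => (wt i : ZMod n)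
  have hw' (m : Fin n →₀ ℕ) : Finsupp.weight w' m = (Finsupp.weight wt m : ZMod n) := by
    simp [Finsupp.weight_apply, Finsupp.sum, w']
  have hW {f} (hf : f ∈ W) : IsWeightedHomogeneous w' f 0 := by
    intro m hm
    rw [hw', ZMod.natCast_eq_zero_iff]
    refine hdvd _ _ (hWt hf (Finsupp.weight wt m))
      (weightedHomogeneousComponent_isWeightedHomogeneous _ _) ?_
    refine ne_zero_iff.2 ⟨m, ?_⟩
    rw [coeff_weightedHomogeneousComponent, if_pos rfl]
    exact hm
  -- The `φ x_j` with `j ≠ r` lie in `W` and generate `ker D`, so all weights in `ker D` are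
  -- divisible by `n`.
  have hker {q} (hq : q ∈ supported K ({r}ᶜ : Set (Fin n))) :
      IsWeightedHomogeneous w' (φ q) 0 := by
    induction hq using Algebra.adjoin_induction with
    | mem q hq =>
      obtain ⟨j, hj, rfl⟩ := hq
      refine hW (f := φ (X j)) (show φ.symm (φ (X j)) ∈ shears H hH r from ?_)
      rw [φ.symm_apply_apply]
      exact X_mem_shears hj
    | algebraMap a =>
      rw [φ.commutes]
      exact isWeightedHomogeneous_C w' a
    | add p q _ _ hp hq => rw [map_add]; exact hp.add hq
    | mul p q _ _ hp hq => rw [map_mul, ← add_zero (0 : ZMod n)]; exact hp.mul hq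
  let x0 : Fin n := ⟨0, by omega⟩
  let x1 : Fin n := ⟨1, by omega⟩
  -- A kernel element of weight two, contradicting `3 ≤ n`.
  let p : MvPolynomial (Fin n) K := X x1 - (2⁻¹ : K) • X x0 ^ 2
  have hp : D p = 0 := by
    rw [map_sub, Derivation.map_smul, Derivation.leibniz_pow, hD0 x0 rfl, hDX x1 x0 rfl,
      ← Nat.cast_smul_eq_nsmul K, smul_smul]
    simp
  have hp' : φ.symm p ∈ supported K ({r}ᶜ : Set (Fin n)) := by
    rw [mem_supported]
    intro j hj
    rintro rfl
    refine vars_of_pderiv_eq_zero ?_ hj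
    apply φ.injective
    rw [← hD, φ.apply_symm_apply, hp, map_zero]
  have h1 := hker hp'
  rw [φ.apply_symm_apply] at h1
  have h2 : coeff (Finsupp.single x1 1) p ≠ 0 := by
    have : Finsupp.single x0 2 ≠ Finsupp.single x1 1 := by
      intro h
      simpa [Finsupp.single_apply, x0, x1] using DFunLike.congr_fun h x0
    simp [p, coeff_X_pow, this]
  have h3 := h1 h2
  rw [hw', Finsupp.weight_single, one_smul, ZMod.natCast_eq_zero_iff] at h3
  have := Nat.le_of_dvd (by simp [wt]) h3
  simp [wt, x1] at this
  omega

end weight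

end PolyAut

/-! ### Nilpotency and the single Jordan block -/

/-- The iterates of a vector under an endomorphism are linearly independent up to the last
nonzero one. -/
theorem linearIndependent_pow_apply {K A : Type*} [Field K] [AddCommGroup A] [Module K A]
    (L : Module.End K A) (ξ : A) (m : ℕ) (hm : (L ^ m) ξ ≠ 0) (hm' : (L ^ (m + 1)) ξ = 0) :
    LinearIndependent K fun i : Fin (m + 1) => (L ^ (i : ℕ)) ξ := by
  rw [Fintype.linearIndependent_iff]
  intro g hg i
  induction i using WellFoundedLT.induction with
  | _ i ih =>
  have h1 := congrArg (L ^ (m - i)) hg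
  rw [map_sum, map_zero, Finset.sum_eq_single i] at h1
  · rw [map_smul, ← Module.End.mul_apply, ← pow_add,
      Nat.sub_add_cancel (Nat.lt_succ_iff.1 i.2)] at h1
    exact (smul_eq_zero.1 h1).resolve_right hm
  · intro j _ hj
    rcases lt_or_gt_of_ne hj with h | h
    · rw [ih j h, zero_smul, map_zero]
    · have h2 : m - i + j = (j - i - 1) + (m + 1) := by
        have := j.2
        have : (i : ℕ) < j := h
        omega
      rw [map_smul, ← Module.End.mul_apply, ← pow_add, h2, pow_add, Module.End.mul_apply, hm',
        map_zero, smul_zero]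
  · simp

namespace PolyAut

variable {n : ℕ} {K : Type*} [Field K]

theorem linearIndependent_one_X :
    LinearIndependent K fun o : Option (Fin n) => o.elim (1 : MvPolynomial (Fin n) K) X := by
  rw [Fintype.linearIndependent_iff]
  intro g hg
  rw [Fintype.sum_option] at hg
  rintro (_ | i)
  · have := congrArg (coeff 0) hg
    simpa [coeff_sum] using this
  · have := congrArg (coeff (Finsupp.single i 1)) hg
    have h0 : (0 : Fin n →₀ ℕ) ≠ Finsupp.single i 1 := fun h0 => by
      simpa using DFunLike.congr_fun h0 i
    simpa [coeff_sum, coeff_one, coeff_X, Finsupp.single_left_inj, h0] using this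

theorem span_one_X :
    Submodule.span K (Set.range fun o : Option (Fin n) => o.elim (1 : MvPolynomial (Fin n) K) X) =
      restrictTotalDegree (Fin n) K 1 := by
  apply le_antisymm
  · rw [Submodule.span_le]
    rintro _ ⟨_ | i, rfl⟩
    · exact (mem_restrictTotalDegree _ _ _).2 (by simp)
    · exact (mem_restrictTotalDegree _ _ _).2 (by simp)
  · intro p hp
    rw [eq_C_add_sum_of_totalDegree_le_one ((mem_restrictTotalDegree _ _ _).1 hp)]
    refine add_mem ?_ (sum_mem fun i _ => ?_)
    · rw [← mul_one (C _), ← smul_eq_C_mul]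
      exact Submodule.smul_mem _ _ (Submodule.subset_span ⟨none, rfl⟩)
    · rw [← smul_eq_C_mul]
      exact Submodule.smul_mem _ _ (Submodule.subset_span ⟨some i, rfl⟩)

variable {D : Derivation K (MvPolynomial (Fin n) K) (MvPolynomial (Fin n) K)}

theorem totalDegree_derivation_le (hle : ∀ i, (D (X i)).totalDegree ≤ 1)
    {p : MvPolynomial (Fin n) K} (hp : p.totalDegree ≤ 1) : (D p).totalDegree ≤ 1 := by
  rw [eq_C_add_sum_of_totalDegree_le_one hp, map_add, map_sum, derivation_C, zero_add]
  refine totalDegree_finsetSum_le fun i _ => ?_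
  rw [← smul_eq_C_mul, Derivation.map_smul]
  exact (totalDegree_smul_le _ _).trans (hle i)

/-- If the affine functions modulo the image of `D` are spanned by a single one, then `D` is
regular nilpotent in suitable affine coordinates. -/
theorem exists_regular_coordinates (hle : ∀ i, (D (X i)).totalDegree ≤ 1) {k : ℕ}
    (hk : ∀ p : MvPolynomial (Fin n) K, p.totalDegree ≤ 1 →
      ((D : Module.End K (MvPolynomial (Fin n) K)) ^ k) p = 0)
    {ξ : MvPolynomial (Fin n) K} (hξ : ξ.totalDegree ≤ 1)
    (hspan : ∀ p : MvPolynomial (Fin n) K, p.totalDegree ≤ 1 →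
      ∃ c : K, ∃ u : MvPolynomial (Fin n) K, u.totalDegree ≤ 1 ∧ p = c • ξ + D u) :
    ∃ γ : PolyAut n K, γ.IsAffine ∧ (∀ i : Fin n, (i : ℕ) = 0 → D (γ (X i)) = 1) ∧
      ∀ i j : Fin n, (i : ℕ) = j + 1 → D (γ (X i)) = γ (X j) := by
  classical
  let L : Module.End K (MvPolynomial (Fin n) K) := D
  have hL (j : ℕ) (p) : (L ^ (j + 1)) p = D ((L ^ j) p) := by
    rw [pow_succ', Module.End.mul_apply]; rfl
  have hdeg (j : ℕ) : ((L ^ j) ξ).totalDegree ≤ 1 := by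
    induction j with
    | zero => exact hξ
    | succ j ih => rw [hL]; exact totalDegree_derivation_le hle ih
  -- Iterating `hspan`; for `j = k` the remainder vanishes, so the iterates of `ξ` span the affine
  -- functions.
  have hgen (j : ℕ) : ∀ p : MvPolynomial (Fin n) K, p.totalDegree ≤ 1 →
      ∃ s ∈ Submodule.span K (Set.range fun i : ℕ => (L ^ i) ξ), ∃ u : MvPolynomial (Fin n) K,
        u.totalDegree ≤ 1 ∧ p = s + (L ^ j) u := by
    induction j with
    | zero => exact fun p hp => ⟨0, zero_mem _, p, hp, by simp⟩
    | succ j ih =>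
      intro p hp
      obtain ⟨s, hs, u, hu, rfl⟩ := ih p hp
      obtain ⟨c, u', hu', rfl⟩ := hspan u hu
      refine ⟨s + c • (L ^ j) ξ, add_mem hs (Submodule.smul_mem _ _
        (Submodule.subset_span ⟨j, rfl⟩)), u', hu', ?_⟩
      rw [pow_succ, Module.End.mul_apply, map_add, map_smul, add_assoc]
      rfl
  have hξ0 : ξ ≠ 0 := by
    rintro rfl
    obtain ⟨s, hs, u, hu, h1⟩ := hgen k 1 (by simp)
    rw [hk u hu, add_zero] at h1
    rw [← h1] at hs
    simp at hs
  have hex : ∃ j, (L ^ j) ξ = 0 := ⟨k, hk ξ hξ⟩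
  obtain ⟨m, hm⟩ : ∃ m, Nat.find hex = m + 1 := by
    refine Nat.exists_eq_succ_of_ne_zero fun h => hξ0 ?_
    simpa [h] using Nat.find_spec hex
  have hm0 : (L ^ m) ξ ≠ 0 := Nat.find_min hex (by omega)
  have hm1 : (L ^ (m + 1)) ξ = 0 := hm ▸ Nat.find_spec hex
  have hind := linearIndependent_pow_apply L ξ m hm0 hm1
  have hspan' : Submodule.span K (Set.range fun i : Fin (m + 1) => (L ^ (i : ℕ)) ξ) =
      restrictTotalDegree (Fin n) K 1 := by
    apply le_antisymm
    · rw [Submodule.span_le]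
      rintro _ ⟨i, rfl⟩
      exact (mem_restrictTotalDegree _ _ _).2 (hdeg i)
    · intro p hp
      obtain ⟨s, hs, u, hu, rfl⟩ := hgen k p ((mem_restrictTotalDegree _ _ _).1 hp)
      rw [hk u hu, add_zero]
      refine Submodule.span_le.2 ?_ hs
      rintro _ ⟨i, rfl⟩
      by_cases hi : i < m + 1
      · exact Submodule.subset_span ⟨⟨i, hi⟩, rfl⟩
      · change (L ^ i) ξ ∈ Submodule.span K _
        rw [← Nat.sub_add_cancel (not_lt.1 hi), pow_add, Module.End.mul_apply, hm1, map_zero]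
        exact zero_mem _
  have hmn : m = n := by
    have h1 := finrank_span_eq_card hind
    have h2 := finrank_span_eq_card (linearIndependent_one_X (n := n) (K := K))
    rw [hspan', ← span_one_X, h2] at h1
    simpa using h1.symm
  subst hmn
  -- As `D 1 = 0`, independence leaves only the last iterate in the expansion of `1`.
  obtain ⟨a, ha⟩ : ∃ a : K, a • (L ^ m) ξ = 1 := by
    have h1 : (1 : MvPolynomial (Fin m) K) ∈ restrictTotalDegree (Fin m) K 1 :=
      (mem_restrictTotalDegree _ _ _).2 (by simp)
    rw [← hspan', Submodule.mem_span_range_iff_exists_fun] at h1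
    obtain ⟨c, hc⟩ := h1
    have h2 := congrArg D hc
    rw [map_sum, Derivation.map_one_eq_zero, Fin.sum_univ_castSucc] at h2
    simp only [Derivation.map_smul, ← hL, Fin.val_castSucc, Fin.val_last, hm1, smul_zero,
      add_zero] at h2
    have h3 := Fintype.linearIndependent_iff.1
      (hind.comp (Fin.succ : Fin m → Fin (m + 1)) (Fin.succ_injective m))
      (fun i => c i.castSucc) (by simpa using h2)
    refine ⟨c (Fin.last m), ?_⟩
    rw [Fin.sum_univ_castSucc] at hc
    simpa [h3] using hc
  have ha0 : a ≠ 0 := by rintro rfl; simp at ha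
  let g : Fin m → MvPolynomial (Fin m) K := fun i => a • (L ^ (m - 1 - i)) ξ
  have hg : ∀ i, X i ∈ (aeval (R := K) g).range := fun i => by
    have h1 : (X i : MvPolynomial (Fin m) K) ∈ restrictTotalDegree (Fin m) K 1 :=
      (mem_restrictTotalDegree _ _ _).2 (by simp)
    rw [← hspan'] at h1
    refine (Submodule.span_le (p := Subalgebra.toSubmodule (aeval (R := K) g).range)).2 ?_ h1
    rintro _ ⟨j, rfl⟩
    have h2 : (L ^ (j : ℕ)) ξ = a⁻¹ • (a • (L ^ (j : ℕ)) ξ) := (inv_smul_smul₀ ha0 _).symm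
    change (L ^ (j : ℕ)) ξ ∈ (aeval (R := K) g).range
    rw [h2]
    refine Subalgebra.smul_mem _ ?_ _
    by_cases hj : (j : ℕ) = m
    · rw [hj, ha]
      exact one_mem _
    · have hj' := j.2
      refine ⟨X ⟨m - 1 - j, by omega⟩, ?_⟩
      change aeval g (X _) = _
      rw [aeval_X]
      simp only [g]
      congr 3
      omega
  refine ⟨ofSurjective g hg, fun i => ?_, fun i hi => ?_, fun i j hij => ?_⟩
  · rw [ofSurjective_X]
    exact (totalDegree_smul_le _ _).trans (hdeg _)
  · have := i.2
    rw [ofSurjective_X, Derivation.map_smul, ← hL, ← ha]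
    congr 3
    omega
  · have := i.2
    rw [ofSurjective_X, ofSurjective_X, Derivation.map_smul, ← hL]
    simp only [g]
    congr 3
    omega

section nilpotent

variable {φ : PolyAut n K} {r : Fin n} (hD : ∀ f, D (φ f) = φ (pderiv r f))

include hD

/-- `D` is conjugate to `∂_r`, and the degrees of the `φ⁻¹ x_i` bound the exponent uniformly. -/
theorem exists_pow_apply_eq_zero : ∃ k : ℕ, ∀ p : MvPolynomial (Fin n) K, p.totalDegree ≤ 1 →
    ((D : Module.End K (MvPolynomial (Fin n) K)) ^ k) p = 0 := by
  let L : Module.End K (MvPolynomial (Fin n) K) := D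
  have hL (j : ℕ) (p) : (L ^ (j + 1)) p = (L ^ j) (D p) := by
    rw [pow_succ, Module.End.mul_apply]; rfl
  have h1 (k : ℕ) : ∀ f : MvPolynomial (Fin n) K, f.totalDegree ≤ k → (L ^ (k + 1)) (φ f) = 0 := by
    induction k with
    | zero =>
      intro f hf
      rw [hL, hD, totalDegree_eq_zero_iff_eq_C.1 (Nat.le_zero.1 hf), pderiv_C, map_zero, map_zero]
    | succ k ih =>
      intro f hf
      rw [hL, hD]
      exact ih _ ((totalDegree_pderiv_le r f).trans (by omega))
  let B := Finset.univ.sup fun i => (φ.symm (X i)).totalDegree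
  refine ⟨B + 1, fun p hp => ?_⟩
  rw [← φ.apply_symm_apply p]
  refine h1 B _ ?_
  rw [eq_C_add_sum_of_totalDegree_le_one hp, map_add, map_sum]
  refine (totalDegree_add _ _).trans (max_le ?_ (totalDegree_finsetSum_le fun i _ => ?_))
  · rw [show φ.symm (C (coeff 0 p)) = C (coeff 0 p) from φ.symm.commutes _]
    simp
  · rw [← smul_eq_C_mul, map_smul]
    exact (totalDegree_smul_le _ _).trans
      (Finset.le_sup (f := fun i => (φ.symm (X i)).totalDegree) (Finset.mem_univ i))

/-- The derivation has no fixed point, so the constants are derivatives of affine functions. -/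
theorem exists_apply_eq_one (hle : ∀ i, (D (X i)).totalDegree ≤ 1) :
    (1 : MvPolynomial (Fin n) K) ∈ (restrictTotalDegree (Fin n) K 1).map
      (D : MvPolynomial (Fin n) K →ₗ[K] MvPolynomial (Fin n) K) := by
  by_contra h
  obtain ⟨l, hl, hS⟩ := Submodule.exists_le_ker_of_notMem h
  have hlD (i : Fin n) : l (D (X i)) = 0 :=
    hS ⟨X i, (mem_restrictTotalDegree _ _ _).2 (by simp), rfl⟩
  -- On affine functions the normalised functional is evaluation at a point. All `D x_i` vanish
  -- there, hence so does every `D f`, against `D (φ x_r) = 1`.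
  let ε : MvPolynomial (Fin n) K →ₐ[K] K := aeval fun i => (l 1)⁻¹ * l (X i)
  have hε {p : MvPolynomial (Fin n) K} (hp : p.totalDegree ≤ 1) : ε p = (l 1)⁻¹ * l p := by
    have h1 : ε.toLinearMap p = ((l 1)⁻¹ • l) p := by
      refine LinearMap.eqOn_span (s := Set.range fun o : Option (Fin n) =>
        o.elim (1 : MvPolynomial (Fin n) K) X) ?_ ?_
      · rintro _ ⟨_ | i, rfl⟩
        · simp [hl]
        · simp [ε]
      · rw [span_one_X]
        exact (mem_restrictTotalDegree _ _ _).2 hp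
    simpa using h1
  have h0 (f : MvPolynomial (Fin n) K) : ε (D f) = 0 := by
    induction f using MvPolynomial.induction_on with
    | C a => simp
    | add p q hp hq => simp [hp, hq]
    | mul_X p i hp =>
      rw [Derivation.leibniz, map_add, smul_eq_mul, smul_eq_mul, map_mul, map_mul, hp,
        hε (hle i), hlD]
      simp
  have := h0 (φ (X r))
  rw [hD, pderiv_X_self, map_one, map_one] at this
  exact one_ne_zero this

end nilpotent

end PolyAut

/-! ### Excluding nonconstant derivations -/

namespace PolyAut

variable {n : ℕ} {K : Type*} [Field K] [CharZero K]
  {H : Subgroup (PolyAut n K)} {hH : ∀ e : PolyAut n K, e.IsAffine → e ∈ H}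
  {φ : PolyAut n K} {r : Fin n}
  {D : Derivation K (MvPolynomial (Fin n) K) (MvPolynomial (Fin n) K)}

/-- A form of `totalDegree_eq_zero_of_dirDeriv_eq_zero` in terms of linear functionals. -/
theorem totalDegree_eq_zero_of_functional (hR : ∀ r, ∀ p ∈ shears H hH r, p.totalDegree ≤ 1)
    (hφ : φ ∈ H) (hD : ∀ f, D (φ f) = φ (pderiv r f)) (hle : ∀ i, (D (X i)).totalDegree ≤ 1)
    (hne : ∃ i, (D (X i)).totalDegree ≠ 0) (l : MvPolynomial (Fin n) K →ₗ[K] K) (h1 : l 1 = 0)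
    (hlD : ∀ p : MvPolynomial (Fin n) K, p.totalDegree ≤ 1 → l (D p) = 0)
    {q : MvPolynomial (Fin n) K} (hq : q.totalDegree ≤ 1) (hlq : l q ≠ 0)
    {f : MvPolynomial (Fin n) K} (hf : φ.symm f ∈ shears H hH r)
    (hlf : dirDeriv (fun i => l (X i)) f = 0) : f.totalDegree = 0 := by
  refine totalDegree_eq_zero_of_dirDeriv_eq_zero hφ hD hR hne (fun h0 => hlq ?_) (fun i => ?_) hf
    hlf
  · have h2 := dirDeriv_of_totalDegree_le_one l h1 hq
    rw [show dirDeriv (fun i => l (X i)) = 0 from derivation_ext fun i => by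
      rw [dirDeriv_X, congrFun h0 i]; simp] at h2
    exact C_injective _ _ (h2.symm.trans C_0.symm)
  · rw [dirDeriv_of_totalDegree_le_one l h1 (hle i), hlD _ (by simp), C_0]

/-- An automorphism conjugating the translations of one variable to affine automorphisms is
affine, unless it generates a nonaffine shear together with the affine automorphisms. -/
theorem isAffine_of_conj_affine (hn : 3 ≤ n)
    (hR : ∀ r, ∀ p ∈ shears H hH r, p.totalDegree ≤ 1)
    (hφ : φ ∈ H) (hD : ∀ f, D (φ f) = φ (pderiv r f)) (hle : ∀ i, (D (X i)).totalDegree ≤ 1) :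
    φ.IsAffine := by
  by_cases hne : ∃ i, (D (X i)).totalDegree ≠ 0
  swap
  · push Not at hne
    exact isAffine_of_totalDegree_eq_zero hR hφ hD hne
  exfalso
  let L : MvPolynomial (Fin n) K →ₗ[K] MvPolynomial (Fin n) K := D
  let V := restrictTotalDegree (Fin n) K 1
  have hV {p} : p ∈ V ↔ p.totalDegree ≤ 1 := mem_restrictTotalDegree _ _ _
  let M := V.map L
  have hDM {p : MvPolynomial (Fin n) K} (hp : p.totalDegree ≤ 1) : D p ∈ M :=
    ⟨p, hV.2 hp, rfl⟩
  have h1M : 1 ∈ M := exists_apply_eq_one hD hle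
  obtain ⟨k, hk⟩ := exists_pow_apply_eq_zero hD
  -- If `D V` were all of `V`, then `1` would lie in `D^k V = 0`.
  obtain ⟨ξ, hξ, hξM⟩ : ∃ ξ ∈ V, ξ ∉ M := by
    by_contra! h
    have h1 (j : ℕ) : ∃ u ∈ V, (L ^ j : Module.End K _) u = 1 := by
      induction j with
      | zero => exact ⟨1, hV.2 (by simp), rfl⟩
      | succ j ih =>
        obtain ⟨u, hu, hu'⟩ := ih
        obtain ⟨u', hu1, rfl⟩ := h u hu
        exact ⟨u', hu1, by rw [pow_succ]; exact hu'⟩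
    obtain ⟨u, hu, hu'⟩ := h1 k
    exact one_ne_zero (hu'.symm.trans (hk u (hV.1 hu)))
  by_cases hcase : V ≤ Submodule.span K {ξ} ⊔ M
  · obtain ⟨γ, hγ, hγ0, hγ1⟩ := exists_regular_coordinates hle hk (hV.1 hξ) fun p hp => by
      obtain ⟨a, ha, b, ⟨u, hu, rfl⟩, hab⟩ := Submodule.mem_sup.1 (hcase (hV.2 hp))
      obtain ⟨c, rfl⟩ := Submodule.mem_span_singleton.1 ha
      exact ⟨c, u, hV.1 hu, hab.symm⟩
    refine false_of_regular (hH := hH) (φ := γ⁻¹ * φ) (r := r) (D := conj γ.symm D) hn hR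
      (H.mul_mem (H.inv_mem (hH _ hγ)) hφ) (fun f => ?_) (fun i hi => ?_) fun i j hij => ?_
    · change γ.symm (D (γ (γ.symm (φ f)))) = γ.symm (φ (pderiv r f))
      rw [γ.apply_symm_apply, hD]
    · change γ.symm (D (γ (X i))) = 1
      rw [hγ0 i hi, map_one]
    · change γ.symm (D (γ (X i))) = X j
      rw [hγ1 i j hij, γ.symm_apply_apply]
  · obtain ⟨ξ', hξ', hξM'⟩ := SetLike.not_le_iff_exists.1 hcase
    obtain ⟨l, hl, hlM⟩ := Submodule.exists_le_ker_of_notMem hξM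
    obtain ⟨l', hl', hlM'⟩ := Submodule.exists_le_ker_of_notMem hξM'
    have hlξ' : l' ξ = 0 :=
      hlM' (Submodule.mem_sup_left (Submodule.mem_span_singleton_self ξ))
    have hlM'' : M ≤ LinearMap.ker l' := le_sup_right.trans hlM'
    have hΔ (l : MvPolynomial (Fin n) K →ₗ[K] K) (hl : M ≤ LinearMap.ker l) {f}
        (hf : φ.symm f ∈ shears H hH r) :
        φ.symm (dirDeriv (fun i => l (X i)) f) ∈ shears H hH r :=
      dirDeriv_mem hφ hD hle (fun i => by
        rw [dirDeriv_of_totalDegree_le_one l (hl h1M) (hle i)]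
        rw [show l (D (X i)) = 0 from hl (hDM (by simp)), C_0]) hf
    obtain ⟨g, ⟨hg, hg0⟩, hmin⟩ : ∃ g, (φ.symm g ∈ shears H hH r ∧ g.totalDegree ≠ 0) ∧
        ∀ g', φ.symm g' ∈ shears H hH r → g'.totalDegree < g.totalDegree →
          g'.totalDegree = 0 := by
      have hex : ∃ d, ∃ g, (φ.symm g ∈ shears H hH r ∧ g.totalDegree ≠ 0) ∧
          g.totalDegree = d := by
        obtain ⟨j, hj⟩ : ∃ j, j ≠ r := by
          have : Nontrivial (Fin n) := Fin.nontrivial_iff_two_le.2 (by omega)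
          exact exists_ne r
        refine ⟨_, φ (X j), ⟨?_, totalDegree_apply_ne_zero φ j⟩, rfl⟩
        rw [φ.symm_apply_apply]
        exact X_mem_shears hj
      classical
      obtain ⟨g, hg, hgd⟩ := Nat.find_spec hex
      refine ⟨g, hg, fun g' hg' hlt => ?_⟩
      by_contra h0
      exact Nat.find_min hex (hgd ▸ hlt) ⟨g', ⟨hg', h0⟩, rfl⟩
    have hconst (l : MvPolynomial (Fin n) K →ₗ[K] K) (hl : M ≤ LinearMap.ker l) :
        ∃ a, dirDeriv (fun i => l (X i)) g = C a := by
      refine ⟨_, totalDegree_eq_zero_iff_eq_C.1 (hmin _ (hΔ l hl hg) ?_)⟩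
      exact (totalDegree_dirDeriv_le _ _).trans_lt (by omega)
    obtain ⟨a, ha⟩ := hconst l hlM
    obtain ⟨b, hb⟩ := hconst l' hlM''
    have ha0 : a ≠ 0 := by
      rintro rfl
      refine hg0 (totalDegree_eq_zero_of_functional hR hφ hD hle hne l (hlM h1M)
        (fun p hp => hlM (hDM hp)) (hV.1 hξ) hl hg (by rw [ha, C_0]))
    let l'' := l' - (b / a) • l
    have hker : M ≤ LinearMap.ker l'' := fun p hp => by
      rw [LinearMap.mem_ker, LinearMap.sub_apply, LinearMap.smul_apply, hlM hp, hlM'' hp]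
      simp
    have hd : dirDeriv (fun i => l'' (X i)) g = 0 := by
      have h2 : dirDeriv (fun i => l'' (X i)) =
          dirDeriv (fun i => l' (X i)) - (b / a) • dirDeriv (fun i => l (X i)) :=
        derivation_ext fun i => by simp [l'', smul_eq_C_mul]
      rw [h2, Derivation.sub_apply, Derivation.smul_apply, ha, hb, smul_eq_C_mul, ← C_mul,
        div_mul_cancel₀ _ ha0, sub_self]
    have hfin {q} (hq : q ∈ V) (hlq : l'' q ≠ 0) : False :=
      hg0 (totalDegree_eq_zero_of_functional hR hφ hD hle hne l'' (hker h1M)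
        (fun p hp => hker (hDM hp)) (hV.1 hq) hlq hg hd)
    by_cases hc : b / a = 0
    · exact hfin hξ' (by simpa [l'', hc] using hl')
    · refine hfin hξ ?_
      simp only [l'', LinearMap.sub_apply, LinearMap.smul_apply, hlξ', zero_sub, smul_eq_mul]
      exact neg_ne_zero.2 (mul_ne_zero hc hl)

end PolyAut

end

/-! ### The theorem -/

theorem theorem1p3 {K : Type*} [Field K] [CharZero K] (n : ℕ) (hn : 3 ≤ n) (φ : GA n K)
    (r : Fin n) (h : ∀ c : K, (φ⁻¹ * GA.translation r c * φ).IsAffine) :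
    φ.IsAffine ∨ φ.IsCotame := by
  refine or_iff_not_imp_right.2 fun hco i => ?_
  let G : Subgroup (GA n K) := Subgroup.closure (insert φ {α | α.IsAffine})
  let H : Subgroup (PolyAut n K) := G.unop
  have hH : ∀ e : PolyAut n K, e.IsAffine → e ∈ H := fun e he =>
    Subgroup.subset_closure (Set.mem_insert_of_mem _ fun i =>
      le_antisymm (he i) (Nat.one_le_iff_ne_zero.2 (e.totalDegree_apply_ne_zero i)))
  have hφ : φ.unop ∈ H := Subgroup.subset_closure (Set.mem_insert _ _)
  have hR : ∀ r, ∀ p ∈ PolyAut.shears H hH r, p.totalDegree ≤ 1 := by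
    by_contra! hR
    obtain ⟨s, p, hp, hp2⟩ := hR
    refine hco ((Subgroup.closure_le _).2 ?_)
    rintro τ (hτ | hτ)
    · exact Subgroup.subset_closure (Set.mem_insert_of_mem _ hτ)
    · exact PolyAut.triangular_mem (H := H) (hH := hH)
        (fun _ _ hq => PolyAut.mem_shears_of_two_le hn hp hp2 hq) n τ.unop hτ
        fun i hi => absurd i.2 (by omega)
  have hD (f) : PolyAut.conj φ.unop (pderiv r) (φ.unop f) = φ.unop (pderiv r f) := by
    rw [PolyAut.conj_apply, AlgEquiv.symm_apply_apply]
  refine le_antisymm (PolyAut.isAffine_of_conj_affine hn hR hφ hD (fun j => ?_) i)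
    (Nat.one_le_iff_ne_zero.2 (PolyAut.totalDegree_apply_ne_zero φ.unop i))
  -- In the opposite group, `φ⁻¹ θ φ` sends `x_j` to `φ (θ (φ⁻¹ x_j))`; its derivative in `c` at
  -- zero is `D x_j`.
  have h1 := mkDerivation_mem ((restrictTotalDegree (Fin n) K 1).comap φ.unop.toLinearMap)
    (Pi.single r 1) (φ.unop.symm (X j)) fun c => by
      have h2 : aeval (R := K) (fun i => X i + C c * (Pi.single r 1 : Fin n → _) i) =
          aeval (Function.update X r (X r + C c)) := by
        congr 1
        ext1 i
        by_cases hi : i = r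
        · subst hi; simp
        · simp [hi]
      rw [h2]
      exact (mem_restrictTotalDegree _ _ _).2 (h c j).le
  rw [mkDerivation_single, one_mul] at h1
  exact (mem_restrictTotalDegree _ _ _).1 h1
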